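/- Let $S$ be a finite set and let $M=(m_{s,t})_{s,t\in S}$ be a Coxeter matrix, i.e. a symmetric matrix with $m_{s,s}=1$ for $s\in S$ and $m_{s,t}\in\{2,3,\dots\}\cup\{\infty\}$ for $s\neq t$. Let $$A_S=\Big\langle S \;\Big|\; \underbrace{sts\cdots}_{m_{s,t}\text{ terms}}=\underbrace{tst\cdots}_{m_{s,t}\text{ terms}},\ s\neq t,\ m_{s,t}\neq\infty\Big\rangle$$ be the associated Artin–Tits group, let $W_S$ be the associated Coxeter group (the quotient of $A_S$ by the relations $s^2=1$, $s\in S$), and let $p:A_S\to W_S$ be the canonical projection. Suppose that $(A_S,S)$ is of spherical type, i.e. that $W_S$ is finite. For $X\subset S$ let $A_X\subset A_S$ and $W_X\subset W_S$ be the subgroups generated by (the images of) $X$. For a subgroup $H$ of a group $G$, write $N_G(H)$ for its normalizer and $Z_G(H)$ for its centralizer in $G$; then $Z_G(H)\cdot H$ is a normal subgroup of $N_G(H)$. Then, for every $X\subset S$, the projection $p$ maps $N_{A_S}(A_X)$ into $N_{W_S}(W_X)$ and induces an isomorphism of groups $$N_{A_S}(A_X)/\big(Z_{A_S}(A_X)\cdot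 A_X\big)\;\xrightarrow{\ \sim\ }\;N_{W_S}(W_X)/\big(Z_{W_S}(W_X)\cdot W_X\big),$$ sending the class of $g$ to the class of $p(g)$. -/

import Mathlib

namespace CoxeterMatrix

variable {B : Type*} (M : CoxeterMatrix B)

/-- The braid relators of a Coxeter matrix `M`: for `s ≠ t` with `M s t ≠ ∞` (Mathlib encodes `∞`
as `0`), the two alternating words in `s`, `t` of length `M s t` (one ending with `t`, the other
with `s`) are to be identified. -/
def braidRelationsSet : Set (FreeGroup B) :=
  {r | ∃ s t : B, s ≠ t ∧ M s t ≠ 0 ∧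
    r = ((CoxeterSystem.braidWord M s t).map FreeGroup.of).prod *
      (((CoxeterSystem.braidWord M t s).map FreeGroup.of).prod)⁻¹}

/-- The Artin–Tits group of a Coxeter matrix: generated by `B`, subject to the braid relations. -/
abbrev ArtinTitsGroup : Type _ := PresentedGroup M.braidRelationsSet

/-- The standard generator of the Artin–Tits group attached to `s`. -/
def artinGen (s : B) : M.ArtinTitsGroup := PresentedGroup.of s

theorem lift_simple_braidRelationsSet (r : FreeGroup B) (hr : r ∈ M.braidRelationsSet) :
    FreeGroup.lift M.simple r = 1 := by
  obtain ⟨s, t, -, -, rfl⟩ := hr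
  have h := M.toCoxeterSystem.wordProd_braidWord_eq s t
  simp only [CoxeterSystem.wordProd, toCoxeterSystem_simple] at h
  rw [map_mul, map_inv, map_list_prod, map_list_prod, mul_inv_eq_one, List.map_map, List.map_map]
  have e : (FreeGroup.lift M.simple : FreeGroup B → M.Group) ∘ FreeGroup.of = M.simple := by
    funext i; simp
  rw [e]
  exact h

/-- The canonical projection from the Artin–Tits group onto the Coxeter group, sending each
standard generator to the corresponding simple reflection. -/
def artinToCoxeter : M.ArtinTitsGroup →* M.Group :=
  PresentedGroup.toGroup M.lift_simple_braidRelationsSet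

theorem artinToCoxeter_artinGen (s : B) : M.artinToCoxeter (M.artinGen s) = M.simple s :=
  PresentedGroup.toGroup.of _

/-- The standard parabolic subgroup `A_X` of the Artin–Tits group. -/
def artinParabolic (X : Set B) : Subgroup M.ArtinTitsGroup :=
  Subgroup.closure (M.artinGen '' X)

/-- The standard parabolic subgroup `W_X` of the Coxeter group. -/
def coxeterParabolic (X : Set B) : Subgroup M.Group :=
  Subgroup.closure (M.simple '' X)

end CoxeterMatrix

namespace Subgroup

variable {G : Type*} [Group G] (H : Subgroup G)

/-- The product `Z_G(H) · H`, a subgroup because `Z_G(H)` commutes with `H`; see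
`mem_centralizerMulSelf` for the description as a product set. -/
def centralizerMulSelf : Subgroup G := centralizer (H : Set G) ⊔ H

theorem mem_centralizerMulSelf {g : G} :
    g ∈ H.centralizerMulSelf ↔ ∃ z ∈ centralizer (H : Set G), ∃ h ∈ H, z * h = g := by
  rw [centralizerMulSelf, ← SetLike.mem_coe,
    coe_mul_of_left_le_normalizer_right _ _ (centralizer_le_normalizer _), Set.mem_mul]
  rfl

instance centralizerMulSelf_normal :
    (H.centralizerMulSelf.subgroupOf (normalizer (H : Set G))).Normal :=
  normal_subgroupOf_of_le_normalizer <|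
    (le_inf (le_normalizer_of_normal_subgroupOf (centralizer_le_normalizer _)) le_rfl).trans
      (normalizer_inf_normalizer_le_normalizer_sup _ _)

/-- The quotient group `N_G(H) / (Z_G(H) · H)`. -/
abbrev NormalizerQuotient : Type _ :=
  normalizer (H : Set G) ⧸ H.centralizerMulSelf.subgroupOf (normalizer (H : Set G))

end Subgroup

/-!
Write `A` for the Artin–Tits group, `W` for the Coxeter group, and `A⁺` for the Artin–Tits monoid,
which has the same presentation as `A`.

An element of `A` that normalizes `A_X` and permutes the generators in `X` by conjugation is
determined, modulo the centralizer of `A_X`, by this permutation, and likewise in `W`. So it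
suffices to know that all elements of the normalizers have this form up to elements of `A_X` and
`W_X`, and that permutations realized in `W` are realized in `A`. The second point rests on the lift `W → A⁺`
given by reduced words, which is well defined by Matsumoto's theorem `prod_map_eq_of_isReduced`: if
`w s = t w` holds in `W` for generators `s` and `t`, then it holds for the lift of `w`
(`posLift_mul_gen`). In `W` the first point is the standard argument with elements of minimal length
in the cosets of `W_X` (`exists_mul_simple_eq`).

In `A` the first point (`exists_mul_artinGen_eq`) uses Garside theory. Multiplication by a central
element makes `g` positive; splitting off a right factor in `A_X`, one may assume that no generator
in `X` divides `g` on the right. As `g` normalizes `A_X`, a comparison of lengths shows that none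
divides it on the left either. Then `g x = b g` with `b = c⁻¹ d` and `c`, `d` positive in `A_X`, so
`c` divides `d g` on the left, and therefore `d` (`exists_eq_mul_of_mul_eq_mul_reduced`). Hence `b`
is positive of length one, which makes it a generator.

The facts on `A⁺` that are needed here are that it is cancellative, that an element divisible by two
generators is divisible by their braid, and that `A⁺` embeds into `A`. The first two come from an
action of `A⁺` on `W × A⁺` that computes normal forms (`pairHom`): the first component of the image
of `(1, 1)` is the largest element of `W` whose lift divides the given element on the left. Its
definition requires meets in the weak order of `W` (`exists_isPrefix_meet`). The longest element of
`W` acts by shifting normal forms, which makes it left cancellable. The embedding follows by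
localization at a central element. The facts on `W` follow from the strong exchange property, and
from the geometric representation, which shows that `s i * s j` has order exactly `M i j`.
-/

/-! ### The geometric representation and the orders of products of two generators -/

namespace CoxeterMatrix

variable {B : Type*} (M : CoxeterMatrix B)

/-- The linear form on the space with basis `B` given by twice the inner product with the basis
vector `i`, for the form `⟨e_i, e_j⟩ = -cos (π / M i j)`. When `M i j` encodes `∞`, the junk value
`π / 0 = 0` gives the usual convention `⟨e_i, e_j⟩ = -1`. -/
noncomputable def geomForm (i : B) : Module.Dual ℝ (B →₀ ℝ) :=
  Finsupp.linearCombination ℝ fun j => -2 * Real.cos (Real.pi / M i j)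

theorem geomForm_single (i j : B) :
    M.geomForm i (Finsupp.single j 1) = -2 * Real.cos (Real.pi / M i j) := by
  simp [geomForm]

theorem geomForm_self (i : B) : M.geomForm i (Finsupp.single i 1) = 2 := by
  simp [geomForm_single]

/-- The reflection by which the simple generator `i` acts in the geometric representation. -/
noncomputable def geomReflection (i : B) : (B →₀ ℝ) ≃ₗ[ℝ] (B →₀ ℝ) :=
  Module.reflection (M.geomForm_self i)

/-- The parameter at which the Chebyshev polynomials are evaluated in the formulas for the powers
of a product of two reflections. -/
theorem geomForm_mul_geomForm (i j : B) :
    M.geomForm i (Finsupp.single j 1) * M.geomForm j (Finsupp.single i 1) - 2 =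
      2 * Real.cos (2 * (Real.pi / M i j)) := by
  rw [geomForm_single, geomForm_single, M.symmetric j i, Real.cos_two_mul]; ring

theorem sin_two_pi_div_pos {m : ℕ} (hm : 3 ≤ m) : 0 < Real.sin (2 * (Real.pi / m)) := by
  have hm' : (3 : ℝ) ≤ m := by exact_mod_cast hm
  apply Real.sin_pos_of_pos_of_lt_pi
  · have := Real.pi_pos; positivity
  · rw [← mul_div_assoc, div_lt_iff₀ (by linarith)]
    nlinarith [Real.pi_pos]

open Polynomial.Chebyshev in
theorem S_eval_two_mul_cos (θ : ℝ) (n : ℤ) :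
    (S ℝ n).eval (2 * Real.cos (2 * θ)) * Real.sin (2 * θ) = Real.sin ((n + 1) * (2 * θ)) :=
  S_two_mul_real_cos _ _

/-- The geometric representation exists: its reflections satisfy the Coxeter relations. -/
theorem geomReflection_isLiftable : M.IsLiftable M.geomReflection := by
  intro i j
  -- The case `M i j = 2` is special, since the Chebyshev polynomials are then evaluated at `-2`,
  -- where the sine by which their values are divided vanishes.
  rcases Nat.lt_or_ge (M i j) 3 with h | h
  · interval_cases hm : M i j
    · simp
    · have : i = j := by
        by_contra hne
        exact M.off_diagonal i j hne hm
      subst this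
      simp only [pow_one, geomReflection]
      ext1 z
      simp only [LinearEquiv.mul_apply, Module.involutive_reflection _ z, LinearEquiv.coe_one, id]
    · have h1 : M.geomForm i (Finsupp.single j 1) = 0 := by
        rw [geomForm_single, hm]; norm_num
      have h2 : M.geomForm j (Finsupp.single i 1) = 0 := by
        rw [geomForm_single, M.symmetric, hm]; norm_num
      rw [pow_two]
      ext1 z
      simp only [geomReflection, LinearEquiv.mul_apply, Module.reflection_apply, map_sub, map_smul,
        h1, h2, geomForm_self, LinearEquiv.coe_one, id]
      module
  · have hs := sin_two_pi_div_pos h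
    have hm0 : (M i j : ℝ) ≠ 0 := by positivity
    have key1 : ∀ k : ℤ, (M i j : ℤ) = 2 * k → (Polynomial.Chebyshev.S ℝ (k - 1)).eval
        (2 * Real.cos (2 * (Real.pi / M i j))) = 0 := by
      intro k hk
      have hk' : (M i j : ℝ) = 2 * k := by exact_mod_cast hk
      refine (mul_eq_zero.1 ?_).resolve_right hs.ne'
      rw [S_eval_two_mul_cos]
      have : (((k - 1 : ℤ) : ℝ) + 1) * (2 * (Real.pi / M i j)) = Real.pi := by
        push_cast; field_simp; linarith
      rw [this, Real.sin_pi]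
    have key2 : ∀ k : ℤ, (M i j : ℤ) = 2 * k + 1 → (Polynomial.Chebyshev.S ℝ k).eval
        (2 * Real.cos (2 * (Real.pi / M i j))) + (Polynomial.Chebyshev.S ℝ (k - 1)).eval
        (2 * Real.cos (2 * (Real.pi / M i j))) = 0 := by
      intro k hk
      have hk' : (M i j : ℝ) = 2 * k + 1 := by exact_mod_cast hk
      refine (mul_eq_zero.1 ?_).resolve_right hs.ne'
      rw [add_mul, S_eval_two_mul_cos, S_eval_two_mul_cos]
      have : (((k - 1 : ℤ) : ℝ) + 1) * (2 * (Real.pi / M i j)) =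
          2 * Real.pi - ((k : ℝ) + 1) * (2 * (Real.pi / M i j)) := by
        push_cast; field_simp; linarith
      rw [this, Real.sin_two_pi_sub]; ring
    ext1 z
    rw [geomReflection, geomReflection, Module.reflection_mul_reflection_pow_apply _ _ _ _
      (2 * Real.cos (2 * (Real.pi / M i j))) (M.geomForm_mul_geomForm i j).symm]
    rcases Int.even_or_odd' (M i j : ℤ) with ⟨k, hk | hk⟩
    · have h1 : ((M i j : ℤ) - 2) / 2 = k - 1 := by omega
      have h2 : ((M i j : ℤ) - 1) / 2 = k - 1 := by omega
      rw [h1, h2, key1 k hk]; simp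
    · have h1 : ((M i j : ℤ) - 1) / 2 = k := by omega
      have h2 : ((M i j : ℤ) - 3) / 2 = k - 1 := by omega
      have h3 : ((M i j : ℤ)) / 2 = k := by omega
      have h4 : ((M i j : ℤ) - 2) / 2 = k - 1 := by omega
      rw [h1, h2, h3, h4, key2 k hk]; simp

theorem geomReflection_mul_pow_ne_one {i j : B} (hij : i ≠ j) {n : ℕ} (hn : 0 < n)
    (hM : M i j = 0 ∨ n < M i j) : (M.geomReflection i * M.geomReflection j) ^ n ≠ 1 := by
  intro h
  -- Compare the coefficients of the two basis vectors in the image of the `i`-th one.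
  have h' := congrArg (fun e => e (Finsupp.single i (1 : ℝ))) h
  simp only [geomReflection] at h'
  rw [Module.reflection_mul_reflection_pow_apply_self _ _ _ 
      (2 * Real.cos (2 * (Real.pi / M i j))) (M.geomForm_mul_geomForm i j).symm]
    at h'
  have hg : M.geomForm j (Finsupp.single i 1) = -2 * Real.cos (Real.pi / M i j) := by
    rw [geomForm_single, M.symmetric]
  rw [hg] at h'
  have hi := DFunLike.congr_fun h' i
  have hj := DFunLike.congr_fun h' j
  simp [hij, hij.symm] at hi hj
  rcases hM with hM | hM
  · simp [hM] at hj
    omega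
  · have hm2 : 2 ≤ M i j := by
      have := M.off_diagonal i j hij; omega
    rcases hm2.eq_or_lt with hm | hm
    · obtain rfl : n = 1 := by omega
      rw [← hm] at hi
      norm_num at hi
      have : 2 * (Real.pi / 2) = Real.pi := by ring
      rw [this] at hi; norm_num at hi
    · have hs := sin_two_pi_div_pos hm
      have hm' : (3 : ℝ) ≤ M i j := by exact_mod_cast hm
      have hc : Real.cos (Real.pi / M i j) ≠ 0 := by
        intro h0
        rw [Real.sin_two_mul, h0] at hs; simp at hs
      have hS := hj.resolve_right hc
      have e1 := S_eval_two_mul_cos (Real.pi / M i j) (n - 1)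
      rw [hS, zero_mul] at e1
      -- The coefficient of the `j`-th vector vanishes only for `2 * n = M i j`, and then the power
      -- sends the `i`-th vector to its negative.
      have hnm : 2 * n = M i j := by
        push_cast at e1
        obtain ⟨k, hk⟩ := Real.sin_eq_zero_iff.1 e1.symm
        have hk' : (k : ℝ) * M i j = 2 * n := by
          have := Real.pi_pos.ne'
          field_simp at hk
          linarith
        have hk2 : k * (M i j : ℤ) = 2 * n := by exact_mod_cast hk'
        have : 0 < k := by
          by_contra hk0
          have : k * (M i j : ℤ) ≤ 0 := mul_nonpos_of_nonpos_of_nonneg (by omega) (by omega)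
          omega
        have : k < 2 := by
          by_contra hk0
          have : 2 * (M i j : ℤ) ≤ k * (M i j : ℤ) := by gcongr; omega
          omega
        obtain rfl : k = 1 := by omega
        omega
      have e2 := S_eval_two_mul_cos (Real.pi / M i j) n
      have : ((n : ℤ) + 1 : ℝ) * (2 * (Real.pi / M i j)) = 2 * (Real.pi / M i j) + Real.pi := by
        have : (M i j : ℝ) = 2 * n := by exact_mod_cast hnm.symm
        rw [this]
        have : (n : ℝ) ≠ 0 := by positivity
        push_cast
        field_simp
        ring
      rw [this, Real.sin_add_pi] at e2
      rw [hS, add_zero] at hi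
      rw [hi] at e2
      linarith

end CoxeterMatrix

namespace CoxeterSystem

variable {B W : Type*} [Group W] {M : CoxeterMatrix B}

/-- The order of `s_i s_j` is not smaller than the entry `M i j`. -/
theorem simple_mul_simple_pow_ne_one (cs : CoxeterSystem M W) {i j : B} (hij : i ≠ j) {n : ℕ}
    (hn : 0 < n) (hM : M i j = 0 ∨ n < M i j) : (cs.simple i * cs.simple j) ^ n ≠ 1 := by
  intro h
  apply M.geomReflection_mul_pow_ne_one hij hn hM
  have := congrArg (cs.lift ⟨_, M.geomReflection_isLiftable⟩) h
  simpa [cs.lift_apply_simple M.geomReflection_isLiftable] using this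

theorem coxeterMatrix_ne_zero (cs : CoxeterSystem M W) [Finite W] (i j : B) : M i j ≠ 0 := by
  intro h
  have hij : i ≠ j := by rintro rfl; simp at h
  exact cs.simple_mul_simple_pow_ne_one hij (orderOf_pos (cs.simple i * cs.simple j)) (.inl h)
    (pow_orderOf_eq_one _)

end CoxeterSystem

/-! ### The strong exchange property -/

namespace CoxeterSystem

variable {B W : Type*} [Group W] {M : CoxeterMatrix B} (cs : CoxeterSystem M W)

open List

theorem reverse_alternatingWord (i j : B) (m : ℕ) :
    (alternatingWord i j m).reverse =
      if Even m then alternatingWord j i m else alternatingWord i j m := by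
  induction m generalizing i j with
  | zero => simp [alternatingWord]
  | succ m ih =>
    rw [alternatingWord_succ, concat_eq_append, reverse_append, ih, ← concat_eq_append,
      ← alternatingWord_succ, alternatingWord_succ', alternatingWord_succ']
    by_cases hm : Even m <;> simp [hm, Nat.even_add_one]

theorem rightInvSeq_append (ω ω' : List B) :
    cs.rightInvSeq (ω ++ ω') =
      (cs.rightInvSeq ω).map (MulAut.conj (cs.wordProd ω')⁻¹) ++ cs.rightInvSeq ω' := by
  induction ω with
  | nil => simp
  | cons i ω ih => simp [rightInvSeq, ih, wordProd_append, mul_assoc]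

open Classical in
/-- The permutation of `W × ℤ/2` attached to a simple generator `s i`: it conjugates the first
component by `s i`, and adds `1` to the second if the first is `s i`. The second component counts,
modulo `2`, how often an element occurs in an inversion sequence. -/
noncomputable def inversionPerm (i : B) : Equiv.Perm (W × ZMod 2) :=
  Function.Involutive.toPerm
    (fun x => (cs.simple i * x.1 * cs.simple i, x.2 + if x.1 = cs.simple i then 1 else 0)) <| by
    rintro ⟨t, ε⟩
    have h : cs.simple i * t * cs.simple i = cs.simple i ↔ t = cs.simple i := by
      constructor
      · intro h
        simpa [mul_assoc] using congrArg (fun x => cs.simple i * x * cs.simple i) h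
      · rintro rfl; simp
    have h2 : (1 : ZMod 2) + 1 = 0 := by decide
    ext
    · simp [mul_assoc]
    · by_cases ht : t = cs.simple i <;> simp [h, ht, add_assoc, h2]

open Classical in
theorem inversionPerm_apply (i : B) (x : W × ZMod 2) :
    cs.inversionPerm i x =
      (cs.simple i * x.1 * cs.simple i, x.2 + if x.1 = cs.simple i then 1 else 0) := rfl

open Classical in
theorem prod_map_inversionPerm (ω : List B) (x : W × ZMod 2) :
    (ω.map cs.inversionPerm).prod x =
      (cs.wordProd ω * x.1 * (cs.wordProd ω)⁻¹, x.2 + (cs.rightInvSeq ω).count x.1) := by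
  induction ω with
  | nil => simp
  | cons i ω ih =>
    rw [map_cons, prod_cons, Equiv.Perm.mul_apply, ih]
    have h : cs.wordProd ω * x.1 * (cs.wordProd ω)⁻¹ = cs.simple i ↔
        (cs.wordProd ω)⁻¹ * cs.simple i * cs.wordProd ω = x.1 := by
      constructor
      · rintro h; rw [← h]; group
      · rintro h; rw [← h]; group
    ext
    · simp [inversionPerm_apply, wordProd_cons, mul_assoc]
    · simp only [inversionPerm_apply, rightInvSeq, count_cons, h, beq_iff_eq]
      split_ifs <;> push_cast <;> ring

theorem prod_map_alternatingWord_two_mul {N : Type*} [Monoid N] (f : B → N) (i j : B) (m : ℕ) :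
    ((alternatingWord i j (2 * m)).map f).prod = (f i * f j) ^ m := by
  induction m with
  | zero => simp [alternatingWord]
  | succ m ih =>
    rw [show 2 * (m + 1) = 2 * m + 1 + 1 by ring, alternatingWord_succ, alternatingWord_succ,
      pow_succ, ← ih]
    simp

/-- The inversion sequence of the word `(s i * s j) ^ M i j` is periodic with period `M i j`, so
that each element occurs in it an even number of times. -/
theorem inversionPerm_isLiftable : M.IsLiftable cs.inversionPerm := by
  classical
  intro i j
  rw [← prod_map_alternatingWord_two_mul]
  ext1 ⟨t, ε⟩
  rw [prod_map_inversionPerm]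
  have hπ : cs.wordProd (alternatingWord i j (2 * M i j)) = 1 := by
    rw [wordProd, prod_map_alternatingWord_two_mul, simple_mul_simple_pow]
  have hr : alternatingWord i j (2 * M i j) = (alternatingWord j i (2 * M i j)).reverse := by
    rw [reverse_alternatingWord, if_pos (even_two_mul _)]
  have hL : (cs.leftInvSeq (alternatingWord j i (2 * M i j))).drop (M i j) =
      (cs.leftInvSeq (alternatingWord j i (2 * M i j))).take (M i j) := by
    apply List.ext_getElem
    · simp; omega
    · intro k h1 h2
      have hk : k < M i j := by simp at h2; omega
      rw [getElem_drop, getElem_take, getElem_leftInvSeq_alternatingWord _ _ _ _ _ (by omega),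
        getElem_leftInvSeq_alternatingWord _ _ _ _ _ (by omega), prod_alternatingWord_eq_mul_pow,
        prod_alternatingWord_eq_mul_pow]
      have e1 : ¬ Even (2 * (M i j + k) + 1) := by simp
      have e2 : ¬ Even (2 * k + 1) := by simp
      rw [if_neg e1, if_neg e2, show (2 * (M i j + k) + 1) / 2 = M i j + k by omega,
        show (2 * k + 1) / 2 = k by omega, pow_add, simple_mul_simple_pow, one_mul]
  have hc : ((cs.rightInvSeq (alternatingWord i j (2 * M i j))).count t : ZMod 2) = 0 := by
    rw [hr, rightInvSeq_reverse, count_reverse,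
      ← take_append_drop (M i j) (cs.leftInvSeq (alternatingWord j i (2 * M i j))), hL,
      count_append, ← two_mul, Nat.cast_mul]
    have : ((2 : ℕ) : ZMod 2) = 0 := by decide
    rw [this, zero_mul]
  simp [hπ, hc]

/-- The action of `W` on `W × ℤ/2` extending `inversionPerm`. -/
noncomputable def inversionHom : W →* Equiv.Perm (W × ZMod 2) :=
  cs.lift ⟨cs.inversionPerm, cs.inversionPerm_isLiftable⟩

open Classical in
theorem inversionHom_wordProd (ω : List B) (t : W) (ε : ZMod 2) :
    cs.inversionHom (cs.wordProd ω) (t, ε) =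
      (cs.wordProd ω * t * (cs.wordProd ω)⁻¹, ε + (cs.rightInvSeq ω).count t) := by
  rw [← prod_map_inversionPerm cs ω (t, ε), wordProd, map_list_prod, map_map]
  congr 3
  funext i
  exact cs.lift_apply_simple cs.inversionPerm_isLiftable i

theorem inversionHom_reflection {t : W} (ht : cs.IsReflection t) :
    cs.inversionHom t (t, 0) = (t, 1) := by
  obtain ⟨u, i, rfl⟩ := ht
  obtain ⟨ω, rfl⟩ := cs.wordProd_surjective u
  have hi : cs.inversionHom (cs.simple i) = cs.inversionPerm i :=
    cs.lift_apply_simple cs.inversionPerm_isLiftable i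
  rw [map_mul, map_mul, Equiv.Perm.mul_apply, Equiv.Perm.mul_apply, map_inv, Equiv.Perm.inv_def]
  obtain ⟨ε, hε⟩ : ∃ ε, cs.inversionHom (cs.wordProd ω) (cs.simple i, ε) =
      (cs.wordProd ω * cs.simple i * (cs.wordProd ω)⁻¹, 0) := by
    classical
    refine ⟨-(cs.rightInvSeq ω).count (cs.simple i), ?_⟩
    rw [inversionHom_wordProd, neg_add_cancel]
  rw [← hε, Equiv.symm_apply_apply, hi]
  rw [inversionHom_wordProd] at hε ⊢
  have h := congrArg Prod.snd hε
  simp only at h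
  simp [inversionPerm_apply, add_right_comm, h]

/-- The strong exchange property: an inversion occurs in the inversion sequence of every word. If it
did not, then `w t` would have `t` as an inversion by parity, so that multiplication by `t` would
shorten both `w` and `w t`. -/
theorem IsRightInversion.mem_rightInvSeq {t : W} {ω : List B}
    (h : cs.IsRightInversion (cs.wordProd ω) t) : t ∈ cs.rightInvSeq ω := by
  classical
  by_contra hmem
  obtain ⟨ω', hω', hω'eq⟩ := cs.exists_isReduced (cs.wordProd ω * t)
  have h0 : cs.inversionHom (cs.wordProd ω * t) (t, 0) = (cs.wordProd ω * t * (cs.wordProd ω)⁻¹, 1)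
      := by
    rw [map_mul, Equiv.Perm.mul_apply, cs.inversionHom_reflection h.1, inversionHom_wordProd,
      count_eq_zero_of_not_mem hmem]
    simp
  have hmem' : t ∈ cs.rightInvSeq ω' := by
    by_contra hm
    rw [hω'eq, inversionHom_wordProd, count_eq_zero_of_not_mem hm] at h0
    simpa using congrArg Prod.snd h0
  have h1 := cs.isRightInversion_of_mem_rightInvSeq hω' hmem'
  rw [← hω'eq] at h1
  have := h1.2
  rw [mul_assoc, h.1.mul_self, mul_one] at this
  exact lt_asymm this h.2

/-- The cocycle property of inversion sets. -/
theorem IsRightInversion.mul {u v t : W} (h : cs.IsRightInversion (u * v) t) :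
    cs.IsRightInversion v t ∨ cs.IsRightInversion u (v * t * v⁻¹) := by
  obtain ⟨ω, hω, rfl⟩ := cs.exists_isReduced u
  obtain ⟨ω', hω', rfl⟩ := cs.exists_isReduced v
  rw [← wordProd_append] at h
  have h1 := h.mem_rightInvSeq
  rw [rightInvSeq_append, mem_append, mem_map] at h1
  rcases h1 with ⟨t', ht', rfl⟩ | h1
  · right
    convert cs.isRightInversion_of_mem_rightInvSeq hω ht' using 1
    simp [mul_assoc]
  · exact .inl (cs.isRightInversion_of_mem_rightInvSeq hω' h1)

theorem IsLeftInversion.mul {u v t : W} (h : cs.IsLeftInversion (u * v) t) :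
    cs.IsLeftInversion u t ∨ cs.IsLeftInversion v (u⁻¹ * t * u) := by
  rw [← isRightInversion_inv_iff, mul_inv_rev] at h
  rcases h.mul with h | h
  · exact .inl (cs.isRightInversion_inv_iff.1 h)
  · right
    rw [← isRightInversion_inv_iff]
    simpa using h

/-! ### Two descents force a braid -/

theorem exists_of_mem_rightInvSeq_alternatingWord {i j : B} {k : ℕ} {t : W}
    (h : t ∈ cs.rightInvSeq (alternatingWord i j k)) :
    ∃ n < k, t = cs.simple j * (cs.simple i * cs.simple j) ^ n := by
  induction k generalizing i j t with
  | zero => simp [alternatingWord] at h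
  | succ k ih =>
    rw [alternatingWord_succ, rightInvSeq_concat, concat_eq_append, mem_append, mem_map,
      mem_singleton] at h
    rcases h with ⟨t', ht', rfl⟩ | rfl
    · obtain ⟨n, hn, rfl⟩ := ih ht'
      refine ⟨n + 1, by omega, ?_⟩
      have : cs.simple i * (cs.simple j * cs.simple i) ^ n =
          (cs.simple i * cs.simple j) ^ n * cs.simple i := (mul_pow_mul _ _ _).symm
      rw [MulAut.conj_apply, this, pow_succ, inv_simple]
      simp [mul_assoc]
    · exact ⟨0, by omega, by simp⟩

/-- If `i` and `j` are right descents of `v`, the alternating words in `i` and `j` are suffixes of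
`v`, up to length `M i j`. A suffix of length `k` is extended by exchange with the other descent;
the exchange cannot delete a letter inside the suffix, as `s i * s j` has order `M i j`. -/
theorem exists_eq_mul_alternatingWord {v : W} {i j : B} (hij : i ≠ j)
    (hi : cs.IsRightDescent v i) (hj : cs.IsRightDescent v j) {k : ℕ} (hk : k ≤ M i j) :
    ∃ y, v = y * cs.wordProd (alternatingWord i j k) ∧ cs.length v = cs.length y + k := by
  induction k generalizing i j with
  | zero => exact ⟨v, by simp [alternatingWord]⟩
  | succ k ih =>
    obtain ⟨y, hy, hl⟩ := ih hij.symm hj hi (by rw [M.symmetric]; omega)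
    have hj' : cs.IsRightInversion v (cs.simple j) :=
      (cs.isRightInversion_simple_iff_isRightDescent v j).2 hj
    rw [hy] at hj'
    rcases hj'.mul with h | h
    · exfalso
      obtain ⟨n, hn, hn'⟩ := cs.exists_of_mem_rightInvSeq_alternatingWord h.mem_rightInvSeq
      apply cs.simple_mul_simple_pow_ne_one hij.symm n.succ_pos (.inr (by rw [M.symmetric]; omega))
      rw [pow_succ', mul_assoc, ← hn']
      simp
    · have hw : cs.wordProd (alternatingWord i j (k + 1)) =
          cs.wordProd (alternatingWord j i k) * cs.simple j := by
        rw [alternatingWord_succ, wordProd_concat]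
      have hl' := h.2
      have hv : v = y * (cs.wordProd (alternatingWord j i k) * cs.simple j *
          (cs.wordProd (alternatingWord j i k))⁻¹) *
          cs.wordProd (alternatingWord i j (k + 1)) := by
        rw [hw, hy]; simp [mul_assoc]
      refine ⟨_, hv, ?_⟩
      have h1 := cs.length_mul_le (y * (cs.wordProd (alternatingWord j i k) * cs.simple j *
          (cs.wordProd (alternatingWord j i k))⁻¹)) (cs.wordProd (alternatingWord i j (k + 1)))
      have h2 := cs.length_wordProd_le (alternatingWord i j (k + 1))
      rw [← hv] at h1
      rw [length_alternatingWord] at h2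
      omega

theorem exists_eq_mul_braidWord {v : W} {i j : B} (hij : i ≠ j)
    (hi : cs.IsRightDescent v i) (hj : cs.IsRightDescent v j) :
    ∃ y, v = y * cs.wordProd (braidWord M i j) ∧ cs.length v = cs.length y + M i j :=
  cs.exists_eq_mul_alternatingWord hij hi hj le_rfl

theorem exists_eq_braidWord_reverse_mul {v : W} {i j : B} (hij : i ≠ j)
    (hi : cs.IsLeftDescent v i) (hj : cs.IsLeftDescent v j) :
    ∃ y, v = cs.wordProd (braidWord M i j).reverse * y ∧ cs.length v = M i j + cs.length y := by
  rw [← isRightDescent_inv_iff] at hi hj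
  obtain ⟨y, hy, hl⟩ := cs.exists_eq_mul_braidWord hij hi hj
  refine ⟨y⁻¹, ?_, ?_⟩
  · rw [wordProd_reverse, ← mul_inv_rev, ← hy, inv_inv]
  · rw [length_inv] at hl
    rw [hl, length_inv, add_comm]

/-! ### Matsumoto's theorem -/

/-- Matsumoto's theorem: a map on the generators that satisfies the braid relations takes the same
value on all reduced words of an element. -/
theorem prod_map_eq_of_isReduced [Finite W] {N : Type*} [Monoid N] {f : B → N}
    (hf : ∀ i j, i ≠ j → ((braidWord M i j).map f).prod = ((braidWord M j i).map f).prod)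
    {ω ω' : List B} (hω : cs.IsReduced ω) (hω' : cs.IsReduced ω')
    (h : cs.wordProd ω = cs.wordProd ω') : (ω.map f).prod = (ω'.map f).prod := by
  induction hn : ω.length using Nat.strong_induction_on generalizing ω ω' with
  | _ n ih =>
    have hlen : ω.length = ω'.length := by rw [← hω.eq, ← hω'.eq, h]
    rcases ω.eq_nil_or_concat with rfl | ⟨η, i, rfl⟩
    · obtain rfl : ω' = [] := by simpa using hlen.symm
      rfl
    rcases ω'.eq_nil_or_concat with rfl | ⟨η', j, rfl⟩
    · simp at hlen
    have hη : cs.IsReduced η := by simpa using hω.take η.length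
    have hη' : cs.IsReduced η' := by simpa using hω'.take η'.length
    simp only [concat_eq_append, length_append, length_singleton] at hlen hn
    have hlη : η.length = η'.length := by omega
    by_cases hij : i = j
    · subst hij
      rw [wordProd_concat, wordProd_concat, mul_left_inj] at h
      simp [ih _ (by omega) hη hη' h rfl]
    have hdi : cs.IsRightDescent (cs.wordProd (η.concat i)) i := by
      rw [IsRightDescent, hω.eq, wordProd_concat, simple_mul_simple_cancel_right, hη.eq]; simp
    have hdj : cs.IsRightDescent (cs.wordProd (η.concat i)) j := by
      rw [h, IsRightDescent, hω'.eq, wordProd_concat, simple_mul_simple_cancel_right, hη'.eq]; simp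
    obtain ⟨y, hy, hl⟩ := cs.exists_eq_mul_braidWord hij hdi hdj
    obtain ⟨ζ, hζ, rfl⟩ := cs.exists_isReduced y
    have hM := cs.coxeterMatrix_ne_zero i j
    have hred : ∀ a b : B, M a b = M i j → cs.wordProd (braidWord M a b) =
        cs.wordProd (braidWord M i j) → cs.IsReduced (ζ ++ braidWord M a b) := by
      intro a b hab hab'
      rw [IsReduced, wordProd_append, hab', ← hy, hl, hζ.eq]
      simp [hab]
    -- Each of the two words can be rewritten, by induction, to end with a braid word.
    have key : ∀ (a b : B) (ξ : List B), M a b = M i j → cs.wordProd (braidWord M a b) =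
        cs.wordProd (braidWord M i j) → cs.IsReduced ξ → ξ.length = η.length →
        cs.wordProd (ξ.concat b) = cs.wordProd (η.concat i) →
        ((ξ.concat b).map f).prod = ((ζ ++ braidWord M a b).map f).prod := by
      intro a b ξ hab hab' hξ hξl hξp
      obtain ⟨k, hk⟩ : ∃ k, M a b = k + 1 := ⟨M a b - 1, by omega⟩
      have hr := hred a b hab hab'
      have hp : cs.wordProd (ζ ++ braidWord M a b) = cs.wordProd (ξ.concat b) := by
        rw [wordProd_append, hab', ← hy, hξp]
      have e : ζ ++ braidWord M a b = (ζ ++ alternatingWord b a k).concat b := by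
        simp [braidWord, hk, alternatingWord_succ]
      rw [e] at hr hp ⊢
      have hr' : cs.IsReduced (ζ ++ alternatingWord b a k) := by
        have := hr.take (ζ ++ alternatingWord b a k).length
        rwa [concat_eq_append, take_left] at this
      rw [wordProd_concat, wordProd_concat, mul_left_inj] at hp
      have := ih _ (by omega) hξ hr' hp.symm rfl
      simp [this, mul_assoc]
    rw [key j i η (M.symmetric j i) (cs.wordProd_braidWord_eq j i) hη rfl rfl,
      key i j η' rfl rfl hη' hlη.symm h.symm, map_append, map_append, prod_append, prod_append,
      hf i j hij]

end CoxeterSystem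

namespace CoxeterSystem

variable {B W : Type*} [Group W] {M : CoxeterMatrix B} (cs : CoxeterSystem M W)

/-! ### The prefix order -/

/-- `u` is a prefix of `v` if some reduced word of `v` starts with a reduced word of `u`. This is
the weak order on `W`. Note that `cs.IsPrefix u (u * v)` says that the lengths of `u` and `v`
add. -/
def IsPrefix (u v : W) : Prop := cs.length u + cs.length (u⁻¹ * v) = cs.length v

variable {cs}

theorem isPrefix_mul {u v : W} :
    cs.IsPrefix u (u * v) ↔ cs.length (u * v) = cs.length u + cs.length v := by
  rw [IsPrefix, inv_mul_cancel_left, eq_comm]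

theorem isPrefix_refl (u : W) : cs.IsPrefix u u := by simp [IsPrefix]

theorem one_isPrefix (u : W) : cs.IsPrefix 1 u := by simp [IsPrefix]

theorem IsPrefix.trans {u v w : W} (h : cs.IsPrefix u v) (h' : cs.IsPrefix v w) :
    cs.IsPrefix u w := by
  have h1 := cs.length_mul_le (u⁻¹ * v) (v⁻¹ * w)
  have h2 := cs.length_mul_le u (u⁻¹ * w)
  rw [mul_assoc, mul_inv_cancel_left] at h1
  rw [mul_inv_cancel_left] at h2
  unfold IsPrefix at *
  omega

theorem IsPrefix.antisymm {u v : W} (h : cs.IsPrefix u v) (h' : cs.IsPrefix v u) : u = v := by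
  unfold IsPrefix at *
  have : cs.length (u⁻¹ * v) = 0 := by omega
  rwa [length_eq_zero_iff, inv_mul_eq_one] at this

/-- If `u ≤ v ≤ w` then `u⁻¹ v ≤ u⁻¹ w`. -/
theorem IsPrefix.inv_mul {u v w : W} (h : cs.IsPrefix u v) (h' : cs.IsPrefix v w) :
    cs.IsPrefix (u⁻¹ * v) (u⁻¹ * w) := by
  have h0 := h.trans h'
  unfold IsPrefix at *
  rw [mul_inv_rev, inv_inv, mul_assoc, mul_inv_cancel_left]
  omega

theorem IsPrefix.of_mul_mul {w u v : W} (h : cs.IsPrefix (w * u) (w * v))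
    (hu : cs.IsPrefix w (w * u)) : cs.IsPrefix u v := by
  simpa using hu.inv_mul h

/-- If the lengths of `w` and `v` add, then left multiplication by `w` is monotone below `v`. -/
theorem IsPrefix.mul_left {w u v : W} (hv : cs.IsPrefix w (w * v)) (h : cs.IsPrefix u v) :
    cs.IsPrefix w (w * u) ∧ cs.IsPrefix (w * u) (w * v) := by
  have h1 := cs.length_mul_le (w * u) (u⁻¹ * v)
  have h2 := cs.length_mul_le w u
  rw [mul_assoc, mul_inv_cancel_left] at h1
  unfold IsPrefix at *
  rw [inv_mul_cancel_left] at *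
  rw [mul_inv_rev, mul_assoc, inv_mul_cancel_left]
  omega

theorem isPrefix_simple_iff {v : W} {i : B} :
    cs.IsPrefix (cs.simple i) v ↔ cs.IsLeftDescent v i := by
  rw [IsPrefix, isLeftDescent_iff, length_simple, inv_simple, add_comm]

/-- A proper prefix `d` of `e` is covered by a prefix of `e`. -/
theorem IsPrefix.exists_simple {d e : W} (h : cs.IsPrefix d e) (hne : d ≠ e) :
    ∃ i, cs.length (d * cs.simple i) = cs.length d + 1 ∧ cs.IsPrefix (d * cs.simple i) e := by
  obtain ⟨i, hi⟩ := cs.exists_leftDescent_of_ne_one (w := d⁻¹ * e) (by rwa [Ne, inv_mul_eq_one])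
  have h0 : cs.IsPrefix d (d * (d⁻¹ * e)) := by rwa [mul_inv_cancel_left]
  obtain ⟨h1, h2⟩ := h0.mul_left (isPrefix_simple_iff.2 hi)
  refine ⟨i, ?_, by simpa using h2⟩
  rw [isPrefix_mul.1 h1, length_simple]

theorem exists_braidWord_reverse_eq_cons {i j : B} (hM : M i j ≠ 0) :
    ∃ ω, (braidWord M i j).reverse = j :: ω := by
  obtain ⟨k, hk⟩ := Nat.exists_eq_succ_of_ne_zero hM
  exact ⟨(alternatingWord j i k).reverse, by rw [braidWord, hk, alternatingWord_succ]; simp⟩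

theorem wordProd_braidWord_reverse (i j : B) :
    cs.wordProd (braidWord M i j).reverse = cs.wordProd (braidWord M j i).reverse := by
  rw [wordProd_reverse, wordProd_reverse, wordProd_braidWord_eq]

theorem isLeftDescent_wordProd_cons {ω : List B} {i : B} (h : cs.IsReduced (i :: ω)) :
    cs.IsLeftDescent (cs.wordProd (i :: ω)) i := by
  have h2 := cs.length_wordProd_le ω
  rw [IsLeftDescent, h.eq, wordProd_cons, simple_mul_simple_cancel_left, List.length_cons]
  omega

variable (cs) in
/-- If `s i` and `s j` are prefixes of some element then the two braid words in `i` and `j` are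
reduced, and their common product is the join of `s i` and `s j`. -/
theorem isPrefix_braidWord [Finite W] {v : W} {i j : B} (hij : i ≠ j)
    (hi : cs.IsPrefix (cs.simple i) v) (hj : cs.IsPrefix (cs.simple j) v) :
    cs.IsReduced (braidWord M i j).reverse ∧
    cs.IsPrefix (cs.simple j) (cs.wordProd (braidWord M i j).reverse) ∧
    cs.IsPrefix (cs.wordProd (braidWord M i j).reverse) v := by
  rw [isPrefix_simple_iff] at hi hj
  obtain ⟨y, hy, hl⟩ := cs.exists_eq_braidWord_reverse_mul hij hi hj
  have h1 := cs.length_wordProd_le (braidWord M i j).reverse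
  have h2 := cs.length_mul_le (cs.wordProd (braidWord M i j).reverse) y
  rw [← hy] at h2
  have h3 : (braidWord M i j).reverse.length = M i j := by simp
  have hred : cs.IsReduced (braidWord M i j).reverse := by
    rw [IsReduced]
    omega
  refine ⟨hred, ?_, ?_⟩
  · obtain ⟨ω, hω⟩ := exists_braidWord_reverse_eq_cons (cs.coxeterMatrix_ne_zero i j)
    rw [isPrefix_simple_iff, hω]
    exact isLeftDescent_wordProd_cons (hω ▸ hred)
  · rw [hy, isPrefix_mul, ← hy]
    omega

/-- If two elements covering `d` lie below `v` then so does their join. -/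
theorem isPrefix_mul_braidWord [Finite W] {d v : W} {i j : B} (hij : i ≠ j)
    (hi : cs.length (d * cs.simple i) = cs.length d + 1)
    (hj : cs.length (d * cs.simple j) = cs.length d + 1)
    (hiv : cs.IsPrefix (d * cs.simple i) v) (hjv : cs.IsPrefix (d * cs.simple j) v) :
    cs.IsPrefix (d * cs.simple i) (d * cs.wordProd (braidWord M i j).reverse) ∧
    cs.IsPrefix (d * cs.simple j) (d * cs.wordProd (braidWord M i j).reverse) ∧
    cs.IsPrefix (d * cs.wordProd (braidWord M i j).reverse) v := by
  have hdi : cs.IsPrefix d (d * cs.simple i) := by rw [isPrefix_mul, hi, length_simple]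
  have hdj : cs.IsPrefix d (d * cs.simple j) := by rw [isPrefix_mul, hj, length_simple]
  have hi' := hdi.inv_mul hiv
  have hj' := hdj.inv_mul hjv
  rw [inv_mul_cancel_left] at hi' hj'
  obtain ⟨-, hjb, hb⟩ := cs.isPrefix_braidWord hij hi' hj'
  obtain ⟨-, hib, -⟩ := cs.isPrefix_braidWord (Ne.symm hij) hj' hi'
  rw [wordProd_braidWord_reverse] at hib
  have hdv : cs.IsPrefix d (d * (d⁻¹ * v)) := by rw [mul_inv_cancel_left]; exact hdi.trans hiv
  obtain ⟨hdb, hbv⟩ := hdv.mul_left hb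
  exact ⟨(hdb.mul_left hib).2, (hdb.mul_left hjb).2, by simpa using hbv⟩

variable (cs) in
/-- The prefix order on a finite Coxeter group has meets. This is Newman's diamond lemma for the
covering relation on the common prefixes of `v` and `w`. -/
theorem exists_isPrefix_meet [Finite W] (v w : W) :
    ∃ m, cs.IsPrefix m v ∧ cs.IsPrefix m w ∧
      ∀ u, cs.IsPrefix u v → cs.IsPrefix u w → cs.IsPrefix u m := by
  have hcov : ∀ {d i}, cs.length (d * cs.simple i) = cs.length d + 1 →
      cs.IsPrefix d (d * cs.simple i) := fun {d i} h => by rw [isPrefix_mul, h, length_simple]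
  let D : Set W := {u | cs.IsPrefix u v ∧ cs.IsPrefix u w}
  have hclosed : ∀ {d e}, cs.IsPrefix d e → e ∈ D → d ∈ D :=
    fun h he => ⟨h.trans he.1, h.trans he.2⟩
  have hL : ∀ {d}, d ∈ D → cs.length d ≤ cs.length v := fun h => by
    have := h.1
    unfold IsPrefix at this
    omega
  let Mx : W → Prop := fun e => e ∈ D ∧ ∀ i, cs.length (e * cs.simple i) = cs.length e + 1 →
    e * cs.simple i ∉ D
  -- Above each `d` in `D` there is exactly one maximal element of `D`.
  have key : ∀ n, ∀ d ∈ D, cs.length v - cs.length d = n →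
      ∃ m, Mx m ∧ cs.IsPrefix d m ∧ ∀ m', Mx m' → cs.IsPrefix d m' → m' = m := by
    intro n
    induction n using Nat.strong_induction_on with
    | _ n ih =>
      intro d hd hn
      by_cases hmax : Mx d
      · refine ⟨d, hmax, isPrefix_refl d, fun m' hm' hdm' => ?_⟩
        by_contra hne
        obtain ⟨i, hi, him⟩ := hdm'.exists_simple (Ne.symm hne)
        exact hmax.2 i hi (hclosed him hm'.1)
      · have : ∃ i, cs.length (d * cs.simple i) = cs.length d + 1 ∧ d * cs.simple i ∈ D := by
          by_contra! h
          exact hmax ⟨hd, h⟩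
        obtain ⟨i, hi, hiD⟩ := this
        have hLi := hL hiD
        obtain ⟨m, hm, hdm, huniq⟩ := ih _ (by omega) _ hiD rfl
        refine ⟨m, hm, (hcov hi).trans hdm, fun m' hm' hdm' => ?_⟩
        obtain ⟨j, hj, hjm'⟩ := hdm'.exists_simple (by rintro rfl; exact hmax hm')
        by_cases hij : i = j
        · subst hij
          exact huniq m' hm' hjm'
        have hjD := hclosed hjm' hm'.1
        have hiv := isPrefix_mul_braidWord hij hi hj hiD.1 hjD.1
        have hiw := isPrefix_mul_braidWord hij hi hj hiD.2 hjD.2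
        obtain ⟨me, hme, heme, -⟩ := ih _ (by
          have := hiv.1
          have := hL ⟨hiv.2.2, hiw.2.2⟩
          unfold IsPrefix at *
          omega) _ ⟨hiv.2.2, hiw.2.2⟩ rfl
        obtain ⟨mj, -, -, huniqj⟩ := ih _ (by omega) _ hjD rfl
        rw [← huniq me hme (hiv.1.trans heme), huniqj me hme (hiv.2.1.trans heme),
          huniqj m' hm' hjm']
  obtain ⟨m, hm, -, huniq⟩ := key _ 1 ⟨one_isPrefix _, one_isPrefix _⟩ rfl
  refine ⟨m, hm.1.1, hm.1.2, fun u hu hu' => ?_⟩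
  obtain ⟨m', hm', hum', -⟩ := key _ u ⟨hu, hu'⟩ rfl
  rwa [← huniq m' hm' (one_isPrefix _)]

/-! ### Longest elements -/

variable (cs) in
/-- The standard parabolic subgroups of a finite Coxeter group have a largest element for the prefix
order. -/
theorem exists_isPrefix_max [Finite W] (X : Set B) :
    ∃ m ∈ Subgroup.closure (cs.simple '' X),
      ∀ u ∈ Subgroup.closure (cs.simple '' X), cs.IsPrefix u m := by
  obtain ⟨m, hm, hmax⟩ := Set.exists_max_image
    (Subgroup.closure (cs.simple '' X) : Set W) cs.length (Set.toFinite _) ⟨1, one_mem _⟩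
  -- An element `m` of maximal length has all reflections of the parabolic subgroup as inversions.
  have step : ∀ u ∈ Subgroup.closure (cs.simple '' X), ∀ i ∈ X, cs.IsPrefix u m →
      cs.IsPrefix (u * cs.simple i) m := by
    intro u hu i hi hum
    rcases cs.length_mul_simple u i with h | h
    · have hu0 : cs.IsPrefix u (u * (u⁻¹ * m)) := by rwa [mul_inv_cancel_left]
      have ht : cs.IsReflection (u * cs.simple i * u⁻¹) := ⟨u, i, rfl⟩
      have htm : cs.IsLeftInversion m (u * cs.simple i * u⁻¹) := by
        refine ⟨ht, lt_of_le_of_ne (hmax _ ?_) (ht.length_mul_right_ne m)⟩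
        exact mul_mem (mul_mem (mul_mem hu (Subgroup.subset_closure ⟨i, hi, rfl⟩)) (inv_mem hu)) hm
      rw [← mul_inv_cancel_left u m] at htm
      rcases htm.mul with h' | h'
      · have := h'.2
        rw [inv_mul_cancel_right] at this
        omega
      · have hs : cs.IsPrefix (cs.simple i) (u⁻¹ * m) := by
          rw [isPrefix_simple_iff, ← isLeftInversion_simple_iff_isLeftDescent]
          convert h' using 1
          group
        simpa using (hu0.mul_left hs).2
    · refine IsPrefix.trans ?_ hum
      rw [IsPrefix, mul_inv_rev, inv_simple, inv_mul_cancel_right, length_simple, h]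
  refine ⟨m, hm, fun u hu => ?_⟩
  induction hu using Subgroup.closure_induction_right with
  | one => exact one_isPrefix _
  | mul_right u hu _ hs h =>
    obtain ⟨i, hi, rfl⟩ := hs
    exact step u hu i hi h
  | mul_inv_cancel u hu _ hs h =>
    obtain ⟨i, hi, rfl⟩ := hs
    rw [inv_simple]
    exact step u hu i hi h

variable (cs) in
/-- A longest element of a parabolic subgroup is an involution that conjugates the generators of
the subgroup to simple generators. -/
theorem mul_self_and_conj_of_isPrefix_max {X : Set B} {m : W}
    (hm : m ∈ Subgroup.closure (cs.simple '' X))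
    (hmax : ∀ u ∈ Subgroup.closure (cs.simple '' X), cs.IsPrefix u m) :
    m * m = 1 ∧ ∀ i ∈ X, ∃ j, m * cs.simple i = cs.simple j * m := by
  have hinv : m⁻¹ = m := by
    have h := hmax _ (inv_mem hm)
    refine h.antisymm ?_
    unfold IsPrefix at *
    rw [length_inv] at *
    have : cs.length (m⁻¹⁻¹ * m) = 0 := by omega
    rw [length_eq_zero_iff, inv_inv] at this
    rw [← mul_inv_rev, this]
    simp
  refine ⟨by nth_rw 1 [← hinv]; simp, fun i hi => ?_⟩
  have hs : cs.simple i ∈ Subgroup.closure (cs.simple '' X) := Subgroup.subset_closure ⟨i, hi, rfl⟩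
  have h1 := hmax _ hs
  have h2 := hmax _ (mul_mem hs hm)
  have h3 : cs.length (m * cs.simple i * m) = 1 := by
    unfold IsPrefix at h1 h2
    rw [length_simple, inv_simple] at h1
    rw [mul_inv_rev, hinv, inv_simple] at h2
    omega
  obtain ⟨j, hj⟩ := cs.length_eq_one_iff.1 h3
  refine ⟨j, ?_⟩
  rw [← hj, mul_assoc]
  nth_rw 4 [← hinv]
  simp

end CoxeterSystem

namespace CoxeterMatrix

open CoxeterSystem

variable {B : Type*} (M : CoxeterMatrix B)

/-! ### The Artin–Tits monoid -/

/-- The braid relations of `M`, as a relation on the free monoid. -/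
def BraidRel (a b : FreeMonoid B) : Prop :=
  ∃ i j : B, i ≠ j ∧ M i j ≠ 0 ∧ a = FreeMonoid.ofList (braidWord M i j) ∧
    b = FreeMonoid.ofList (braidWord M j i)

/-- The Artin–Tits monoid of `M`: the monoid with the presentation that defines the Artin–Tits
group. -/
abbrev ArtinTitsMonoid : Type _ := PresentedMonoid M.BraidRel

/-- The generator of the Artin–Tits monoid attached to `i`. -/
def monoidGen (i : B) : M.ArtinTitsMonoid := PresentedMonoid.of _ i

/-- The element of the Artin–Tits monoid represented by a word. -/
def monoidProd (ω : List B) : M.ArtinTitsMonoid := (ω.map M.monoidGen).prod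

@[simp] theorem monoidProd_nil : M.monoidProd [] = 1 := rfl

theorem monoidProd_cons (i : B) (ω : List B) :
    M.monoidProd (i :: ω) = M.monoidGen i * M.monoidProd ω := by simp [monoidProd]

theorem monoidProd_append (ω ω' : List B) :
    M.monoidProd (ω ++ ω') = M.monoidProd ω * M.monoidProd ω' := by simp [monoidProd]

theorem monoidProd_eq_mk (ω : List B) :
    M.monoidProd ω = PresentedMonoid.mk _ (FreeMonoid.ofList ω) := by
  induction ω with
  | nil => rfl
  | cons i ω ih => rw [monoidProd_cons, ih, FreeMonoid.ofList_cons, map_mul]; rfl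

theorem monoidProd_surjective : Function.Surjective M.monoidProd := by
  intro a
  obtain ⟨ω, rfl⟩ := PresentedMonoid.surjective_mk a
  exact ⟨ω.toList, M.monoidProd_eq_mk _⟩

variable {M} in
@[elab_as_elim]
theorem monoid_induction {p : M.ArtinTitsMonoid → Prop} (a : M.ArtinTitsMonoid) (one : p 1)
    (gen_mul : ∀ i a, p a → p (M.monoidGen i * a)) : p a := by
  obtain ⟨ω, rfl⟩ := M.monoidProd_surjective a
  induction ω with
  | nil => exact one
  | cons i ω ih => rw [monoidProd_cons]; exact gen_mul _ _ ih

theorem monoidProd_braidWord {i j : B} (hij : i ≠ j) (hM : M i j ≠ 0) :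
    M.monoidProd (braidWord M i j) = M.monoidProd (braidWord M j i) := by
  rw [monoidProd_eq_mk, monoidProd_eq_mk]
  exact PresentedMonoid.mk_eq_mk_of_rel ⟨i, j, hij, hM, rfl, rfl⟩

theorem monoidProd_braidWord_reverse {i j : B} (hij : i ≠ j) (hM : M i j ≠ 0) :
    M.monoidProd (braidWord M i j).reverse = M.monoidProd (braidWord M j i).reverse := by
  have h := M.monoidProd_braidWord hij hM
  rw [braidWord, braidWord, M.symmetric j i] at *
  rw [reverse_alternatingWord, reverse_alternatingWord]
  split_ifs
  · exact h.symm
  · exact h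

/-- The universal property of the Artin–Tits monoid. -/
def monoidLift {N : Type*} [Monoid N] (f : B → N)
    (hf : ∀ i j, i ≠ j → M i j ≠ 0 →
      ((braidWord M i j).map f).prod = ((braidWord M j i).map f).prod) : M.ArtinTitsMonoid →* N :=
  PresentedMonoid.lift f <| by
    rintro _ _ ⟨i, j, hij, hM, rfl, rfl⟩
    simpa [FreeMonoid.lift_apply] using hf i j hij hM

theorem monoidLift_gen {N : Type*} [Monoid N] (f : B → N) (hf) (i : B) :
    M.monoidLift f hf (M.monoidGen i) = f i := rfl

theorem map_monoidProd {N : Type*} [Monoid N] (φ : M.ArtinTitsMonoid →* N) (ω : List B) :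
    φ (M.monoidProd ω) = (ω.map fun i => φ (M.monoidGen i)).prod := by
  rw [monoidProd, map_list_prod, List.map_map]; rfl

theorem length_braidWord (i j : B) : (braidWord M i j).length = M i j :=
  length_alternatingWord ..

/-- The word length on the Artin–Tits monoid, well defined because the braid relations are
homogeneous. -/
def monoidLength : M.ArtinTitsMonoid →* Multiplicative ℕ :=
  M.monoidLift (fun _ => Multiplicative.ofAdd 1) fun i j _ _ => by
    rw [List.map_const', List.map_const', List.prod_replicate, List.prod_replicate,
      length_braidWord, length_braidWord, M.symmetric]

variable {M} in
/-- The word length of an element of the Artin–Tits monoid. -/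
def len (a : M.ArtinTitsMonoid) : ℕ := (M.monoidLength a).toAdd

@[simp] theorem len_one : len (1 : M.ArtinTitsMonoid) = 0 := by simp [len]

@[simp] theorem len_mul (a b : M.ArtinTitsMonoid) : len (a * b) = len a + len b := by simp [len]

@[simp] theorem len_gen (i : B) : len (M.monoidGen i) = 1 := rfl

theorem exists_eq_gen_mul {a : M.ArtinTitsMonoid} (ha : a ≠ 1) :
    ∃ i b, a = M.monoidGen i * b := by
  induction a using monoid_induction with
  | one => exact absurd rfl ha
  | gen_mul i a _ => exact ⟨i, a, rfl⟩

theorem len_eq_zero {a : M.ArtinTitsMonoid} (h : len a = 0) : a = 1 := by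
  by_contra ha
  obtain ⟨i, b, rfl⟩ := M.exists_eq_gen_mul ha
  rw [len_mul, len_gen] at h
  omega

theorem exists_eq_gen_of_len {a : M.ArtinTitsMonoid} (h : len a = 1) : ∃ i, a = M.monoidGen i := by
  obtain ⟨i, b, rfl⟩ := M.exists_eq_gen_mul (a := a) (by rintro rfl; simp at h)
  rw [len_mul, len_gen] at h
  exact ⟨i, by rw [M.len_eq_zero (a := b) (by omega), mul_one]⟩

theorem mem_braidWord {i j k : B} (hij : i ≠ j) (hM : M i j ≠ 0) :
    k ∈ braidWord M i j ↔ k = i ∨ k = j := by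
  have h2 : 2 ≤ M i j := by have := M.off_diagonal i j hij; omega
  obtain ⟨m, hm⟩ := Nat.exists_eq_add_of_le' h2
  constructor
  · have : ∀ n, ∀ {i j}, k ∈ alternatingWord i j n → k = i ∨ k = j := by
      intro n
      induction n with
      | zero => simp [alternatingWord]
      | succ n ih =>
        intro i j h
        rw [alternatingWord_succ, List.concat_eq_append, List.mem_append, List.mem_singleton] at h
        rcases h with h | h
        · exact (ih h).symm
        · exact .inr h
    exact this _
  · rw [braidWord, hm, alternatingWord_succ, alternatingWord_succ]
    rintro (rfl | rfl) <;> simp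

open Classical in
theorem prod_map_ite_mem (X : Set B) (ω : List B) :
    (ω.map fun i => if i ∈ X then (1 : ℕ) else 0).prod = if ∀ i ∈ ω, i ∈ X then 1 else 0 := by
  induction ω with
  | nil => simp
  | cons i ω ih => by_cases hi : i ∈ X <;> simp [ih, hi]

open Classical in
/-- The homomorphism to `(ℕ, ·)` that takes the value `1` on the words in `X`, and `0` on all other
words. It is well defined because both sides of a braid relation use the same letters. -/
noncomputable def supportHom (X : Set B) : M.ArtinTitsMonoid →* ℕ :=
  M.monoidLift (fun i => if i ∈ X then 1 else 0) fun i j hij hM => by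
    rw [prod_map_ite_mem, prod_map_ite_mem]
    simp [M.mem_braidWord hij hM, M.mem_braidWord hij.symm (M.symmetric i j ▸ hM), and_comm]

/-- The standard parabolic submonoid: the elements represented by words in `X`. -/
noncomputable def monoidParabolic (X : Set B) : Submonoid M.ArtinTitsMonoid :=
  MonoidHom.mker (M.supportHom X)

variable {M}

theorem mul_mem_monoidParabolic {X : Set B} {a b : M.ArtinTitsMonoid} :
    a * b ∈ M.monoidParabolic X ↔ a ∈ M.monoidParabolic X ∧ b ∈ M.monoidParabolic X := by
  simp [monoidParabolic, MonoidHom.mem_mker]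

theorem gen_mem_monoidParabolic {X : Set B} {i : B} :
    M.monoidGen i ∈ M.monoidParabolic X ↔ i ∈ X := by
  simp [monoidParabolic, MonoidHom.mem_mker, supportHom, monoidLift_gen]

/-- The anti-automorphism of the Artin–Tits monoid that reverses words. -/
def monoidRevHom (M : CoxeterMatrix B) : M.ArtinTitsMonoid →* M.ArtinTitsMonoidᵐᵒᵖ :=
  M.monoidLift (fun i => MulOpposite.op (M.monoidGen i)) fun i j hij hM => by
    have h : ∀ ω : List B, (ω.map fun i => MulOpposite.op (M.monoidGen i)).prod =
        MulOpposite.op (M.monoidProd ω.reverse) := by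
      intro ω
      induction ω with
      | nil => rfl
      | cons i ω ih => simp [ih, monoidProd]
    rw [h, h, M.monoidProd_braidWord_reverse hij hM]

/-- The reversal of an element of the Artin–Tits monoid. -/
def rev (a : M.ArtinTitsMonoid) : M.ArtinTitsMonoid := (M.monoidRevHom a).unop

@[simp] theorem rev_one : rev (1 : M.ArtinTitsMonoid) = 1 := by simp [rev]

@[simp] theorem rev_mul (a b : M.ArtinTitsMonoid) : rev (a * b) = rev b * rev a := by simp [rev]

@[simp] theorem rev_gen (i : B) : rev (M.monoidGen i) = M.monoidGen i := rfl

@[simp] theorem rev_rev (a : M.ArtinTitsMonoid) : rev (rev a) = a := by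
  induction a using monoid_induction with
  | one => simp
  | gen_mul i a ih => simp [ih]

theorem rev_mem_monoidParabolic {X : Set B} {a : M.ArtinTitsMonoid} :
    rev a ∈ M.monoidParabolic X ↔ a ∈ M.monoidParabolic X := by
  induction a using monoid_induction with
  | one => simp
  | gen_mul i a ih => simp [mul_mem_monoidParabolic, ih, and_comm]

/-- The map from the Artin–Tits monoid to the Artin–Tits group. -/
def monoidToGroup (M : CoxeterMatrix B) : M.ArtinTitsMonoid →* M.ArtinTitsGroup :=
  M.monoidLift M.artinGen fun i j hij hM => by
    have h : ∀ ω : List B, (ω.map M.artinGen).prod =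
        PresentedGroup.mk _ (ω.map FreeGroup.of).prod := by
      intro ω
      rw [map_list_prod, List.map_map]; rfl
    rw [h, h, ← mul_inv_eq_one, ← map_inv, ← map_mul]
    exact PresentedGroup.one_of_mem ⟨i, j, hij, hM, rfl⟩

theorem monoidToGroup_gen (i : B) : M.monoidToGroup (M.monoidGen i) = M.artinGen i := rfl

theorem monoidToGroup_mem_artinParabolic {X : Set B} {a : M.ArtinTitsMonoid}
    (ha : a ∈ M.monoidParabolic X) : M.monoidToGroup a ∈ M.artinParabolic X := by
  induction a using monoid_induction with
  | one => simp
  | gen_mul i a ih =>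
    rw [mul_mem_monoidParabolic, gen_mem_monoidParabolic] at ha
    rw [map_mul]
    exact mul_mem (Subgroup.subset_closure ⟨i, ha.1, rfl⟩) (ih ha.2)

end CoxeterMatrix

namespace CoxeterSystem

open CoxeterMatrix

variable {B W : Type*} [Group W] {M : CoxeterMatrix B} (cs : CoxeterSystem M W)

/-! ### The lift of a Coxeter group to its Artin–Tits monoid -/

/-- The lift of `w` to the Artin–Tits monoid, represented by any reduced word of `w`. -/
noncomputable def posLift (w : W) : M.ArtinTitsMonoid :=
  M.monoidProd (cs.exists_isReduced w).choose

theorem posLift_wordProd [Finite W] {ω : List B} (hω : cs.IsReduced ω) :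
    cs.posLift (cs.wordProd ω) = M.monoidProd ω := by
  obtain ⟨h1, h2⟩ := (cs.exists_isReduced (cs.wordProd ω)).choose_spec
  exact cs.prod_map_eq_of_isReduced
    (fun i j hij => M.monoidProd_braidWord hij (cs.coxeterMatrix_ne_zero i j)) h1 hω h2.symm

variable [Finite W]

@[simp] theorem posLift_one : cs.posLift 1 = 1 := by
  simpa using cs.posLift_wordProd (ω := []) (by simp [IsReduced])

@[simp] theorem posLift_simple (i : B) : cs.posLift (cs.simple i) = M.monoidGen i := by
  simpa [monoidProd] using cs.posLift_wordProd (ω := [i]) (by simp [IsReduced])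

theorem posLift_mul {u v : W} (h : cs.length (u * v) = cs.length u + cs.length v) :
    cs.posLift (u * v) = cs.posLift u * cs.posLift v := by
  obtain ⟨ω, hω, rfl⟩ := cs.exists_isReduced u
  obtain ⟨ω', hω', rfl⟩ := cs.exists_isReduced v
  rw [cs.posLift_wordProd hω, cs.posLift_wordProd hω', ← wordProd_append, posLift_wordProd,
    monoidProd_append]
  rw [IsReduced, wordProd_append, h, hω.eq, hω'.eq, List.length_append]

variable {cs} in
theorem IsPrefix.posLift_eq {u v : W} (h : cs.IsPrefix u v) :
    cs.posLift v = cs.posLift u * cs.posLift (u⁻¹ * v) := by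
  rw [← posLift_mul, mul_inv_cancel_left]
  rw [mul_inv_cancel_left, h]

/-- A relation `w s_i = s_j w` holds in the Artin–Tits monoid as soon as it holds in the Coxeter
group. -/
theorem posLift_mul_gen {w : W} {i j : B} (h : w * cs.simple i = cs.simple j * w) :
    cs.posLift w * M.monoidGen i = M.monoidGen j * cs.posLift w := by
  rcases cs.length_mul_simple w i with hl | hl
  · rw [← posLift_simple cs i, ← posLift_simple cs j, ← posLift_mul _ (by simpa using hl),
      ← posLift_mul, h]
    rw [← h, hl, length_simple, add_comm]
  · -- Here `w = u s_i = s_j u` with `u = w s_i` shorter than `w`.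
    have h1 : cs.posLift w = cs.posLift (w * cs.simple i) * M.monoidGen i := by
      rw [← posLift_simple cs i, ← posLift_mul] <;> simp [hl]
    have h2 : cs.posLift w = M.monoidGen j * cs.posLift (w * cs.simple i) := by
      rw [← posLift_simple cs j, ← posLift_mul] <;> simp [h]
      rw [← h, ← hl, add_comm]
    nth_rw 1 [h2]
    rw [mul_assoc, ← h1]

/-- Lifts of elements of a standard parabolic subgroup are words in its generators, because
parabolic submonoids are closed under divisors. -/
theorem posLift_mem_monoidParabolic {X : Set B} {u : W}
    (hu : u ∈ Subgroup.closure (cs.simple '' X)) : cs.posLift u ∈ M.monoidParabolic X := by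
  have step : ∀ u : W, ∀ i ∈ X, cs.posLift u ∈ M.monoidParabolic X →
      cs.posLift (u * cs.simple i) ∈ M.monoidParabolic X := by
    intro u i hi hu
    rcases cs.length_mul_simple u i with hl | hl
    · rw [posLift_mul _ (by simpa using hl), posLift_simple, mul_mem_monoidParabolic,
        gen_mem_monoidParabolic]
      exact ⟨hu, hi⟩
    · have h1 : cs.posLift u = cs.posLift (u * cs.simple i) * cs.posLift (cs.simple i) := by
        rw [← posLift_mul] <;> simp [hl]
      rw [h1, mul_mem_monoidParabolic] at hu
      exact hu.1
  induction hu using Subgroup.closure_induction_right with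
  | one => simp
  | mul_right u _ _ hs h =>
    obtain ⟨i, hi, rfl⟩ := hs
    exact step u i hi h
  | mul_inv_cancel u _ _ hs h =>
    obtain ⟨i, hi, rfl⟩ := hs
    rw [inv_simple]
    exact step u i hi h

end CoxeterSystem

namespace CoxeterSystem

open CoxeterMatrix

variable {B W : Type*} [Group W] {M : CoxeterMatrix B} (cs : CoxeterSystem M W) [Finite W]

/-! ### The action on normal forms -/

theorem exists_forall_isPrefix : ∃ m : W, ∀ u, cs.IsPrefix u m := by
  obtain ⟨m, -, hm⟩ := cs.exists_isPrefix_max Set.univ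
  refine ⟨m, fun u => hm u ?_⟩
  rw [Set.image_univ, cs.subgroup_closure_range_simple]
  trivial

/-- The longest element of a finite Coxeter group. -/
noncomputable def longest : W := cs.exists_forall_isPrefix.choose

theorem isPrefix_longest (u : W) : cs.IsPrefix u cs.longest :=
  cs.exists_forall_isPrefix.choose_spec u

/-- Among the prefixes `u` of `v` such that the lengths of `w` and `u` add, there is a largest one:
it is the meet of `v` with the complement `w⁻¹ w₀` of `w`. -/
theorem exists_absorb (w v : W) :
    ∃ c, cs.IsPrefix c v ∧ cs.IsPrefix w (w * c) ∧
      ∀ u, cs.IsPrefix u v → cs.IsPrefix w (w * u) → cs.IsPrefix u c := by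
  obtain ⟨c, hcv, hcw, hc⟩ := cs.exists_isPrefix_meet v (w⁻¹ * cs.longest)
  have hw : cs.IsPrefix w (w * (w⁻¹ * cs.longest)) := by
    rw [mul_inv_cancel_left]
    exact cs.isPrefix_longest w
  refine ⟨c, hcv, (hw.mul_left hcw).1, fun u huv huw => hc u huv ?_⟩
  simpa using huw.inv_mul (cs.isPrefix_longest (w * u))

/-- The largest prefix of `v` whose length adds to that of `w`. -/
noncomputable def absorb (w v : W) : W := (cs.exists_absorb w v).choose

theorem absorb_isPrefix (w v : W) : cs.IsPrefix (cs.absorb w v) v :=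
  (cs.exists_absorb w v).choose_spec.1

theorem isPrefix_mul_absorb (w v : W) : cs.IsPrefix w (w * cs.absorb w v) :=
  (cs.exists_absorb w v).choose_spec.2.1

theorem isPrefix_absorb {w v u : W} (h : cs.IsPrefix u v) (h' : cs.IsPrefix w (w * u)) :
    cs.IsPrefix u (cs.absorb w v) :=
  (cs.exists_absorb w v).choose_spec.2.2 u h h'

theorem absorb_eq {w v c : W} (h1 : cs.IsPrefix c v) (h2 : cs.IsPrefix w (w * c))
    (h3 : ∀ u, cs.IsPrefix u v → cs.IsPrefix w (w * u) → cs.IsPrefix u c) : cs.absorb w v = c :=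
  (h3 _ (cs.absorb_isPrefix w v) (cs.isPrefix_mul_absorb w v)).antisymm (cs.isPrefix_absorb h1 h2)

/-- Left multiplication of a pair `(v, g)` by `w`, where a pair stands for the product of the lift
of `v` with `g`: the first component takes up as much of `v` as fits, and the rest of `v` is pushed
into the second component. -/
noncomputable def pairAct (w : W) (x : W × M.ArtinTitsMonoid) : W × M.ArtinTitsMonoid :=
  (w * cs.absorb w x.1, cs.posLift ((cs.absorb w x.1)⁻¹ * x.1) * x.2)

theorem pairAct_one (x : W × M.ArtinTitsMonoid) : cs.pairAct 1 x = x := by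
  have h : cs.absorb 1 x.1 = x.1 :=
    cs.absorb_eq (isPrefix_refl _) (one_isPrefix _) fun u hu _ => hu
  simp [pairAct, h]

theorem pairAct_longest (x : W × M.ArtinTitsMonoid) :
    cs.pairAct cs.longest x = (cs.longest, cs.posLift x.1 * x.2) := by
  have h : cs.absorb cs.longest x.1 = 1 := by
    have h1 := (cs.isPrefix_longest _).antisymm (cs.isPrefix_mul_absorb cs.longest x.1)
    simpa using h1
  simp [pairAct, h]

/-- Both sides take up the same part of `v`, and leave the same remainder. -/
theorem pairAct_mul {w₁ w₂ : W} (h : cs.IsPrefix w₁ (w₁ * w₂)) (x : W × M.ArtinTitsMonoid) :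
    cs.pairAct w₁ (cs.pairAct w₂ x) = cs.pairAct (w₁ * w₂) x := by
  obtain ⟨v, g⟩ := x
  have hc2 := cs.absorb_isPrefix w₂ v
  have hwc2 := cs.isPrefix_mul_absorb w₂ v
  set c₂ := cs.absorb w₂ v with hc2_def
  have hc1 := cs.absorb_isPrefix w₁ (w₂ * c₂)
  have hwc1 := cs.isPrefix_mul_absorb w₁ (w₂ * c₂)
  have hw2 := cs.isPrefix_absorb hwc2 h
  set c₁ := cs.absorb w₁ (w₂ * c₂) with hc1_def
  obtain ⟨d, hd⟩ : ∃ d, c₁ = w₂ * d := ⟨w₂⁻¹ * c₁, by simp⟩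
  rw [hd] at hc1 hwc1 hw2
  have hdc2 : cs.IsPrefix d c₂ := IsPrefix.of_mul_mul hc1 hw2
  have hwd : cs.IsPrefix (w₁ * w₂) (w₁ * w₂ * d) := by
    simpa [mul_assoc] using (hwc1.mul_left hw2).2
  have habs : cs.absorb (w₁ * w₂) v = d := by
    refine cs.absorb_eq (hdc2.trans hc2) hwd fun u hu hwu => ?_
    have hw2u : cs.IsPrefix w₂ (w₂ * u) := by
      have := h.trans hwu
      have := h.inv_mul hwu
      simpa [mul_assoc] using this
    have huc2 := cs.isPrefix_absorb hu hw2u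
    have hw1u : cs.IsPrefix w₁ (w₁ * (w₂ * u)) := by
      rw [← mul_assoc]
      exact h.trans hwu
    have := cs.isPrefix_absorb (hwc2.mul_left huc2).2 hw1u
    rw [← hc1_def, hd] at this
    exact IsPrefix.of_mul_mul this hw2u
  simp only [pairAct, ← hc2_def, ← hc1_def, habs, hd]
  ext1
  · simp [mul_assoc]
  · have h1 := hdc2.inv_mul hc2
    have h2 := h1.posLift_eq
    simp only [mul_inv_rev, mul_assoc, inv_mul_cancel_left] at h2 ⊢
    rw [← mul_assoc, h2]

/-- `pairAct` for a generator, as an element of the endomorphism monoid. -/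
noncomputable def pairEnd (i : B) : Function.End (W × M.ArtinTitsMonoid) :=
  cs.pairAct (cs.simple i)

theorem prod_map_pairEnd {ω : List B} (hω : cs.IsReduced ω) :
    (ω.map cs.pairEnd).prod = cs.pairAct (cs.wordProd ω) := by
  induction ω with
  | nil => rw [wordProd_nil, funext cs.pairAct_one]; rfl
  | cons i ω ih =>
    have hω' : cs.IsReduced ω := by simpa using hω.drop 1
    rw [List.map_cons, List.prod_cons, ih hω', wordProd_cons]
    funext x
    refine cs.pairAct_mul ?_ x
    rw [isPrefix_mul, ← wordProd_cons, hω.eq, hω'.eq, length_simple, List.length_cons, add_comm]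

theorem isReduced_braidWord {i j : B} (hij : i ≠ j) : cs.IsReduced (braidWord M i j) := by
  rw [← isReduced_reverse_iff]
  exact (cs.isPrefix_braidWord hij (cs.isPrefix_longest _) (cs.isPrefix_longest _)).1

/-- The action of the Artin–Tits monoid on pairs, which puts the elements of the monoid in normal
form: the image of `(1, 1)` under `a` consists of the largest element of `W` whose lift divides `a`
on the left, and of the quotient. -/
noncomputable def pairHom : M.ArtinTitsMonoid →* Function.End (W × M.ArtinTitsMonoid) :=
  M.monoidLift cs.pairEnd fun i j hij _ => by
    rw [cs.prod_map_pairEnd (cs.isReduced_braidWord hij),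
      cs.prod_map_pairEnd (cs.isReduced_braidWord hij.symm), wordProd_braidWord_eq]

theorem pairHom_posLift (w : W) : cs.pairHom (cs.posLift w) = cs.pairAct w := by
  obtain ⟨ω, hω, rfl⟩ := cs.exists_isReduced w
  rw [cs.posLift_wordProd hω, map_monoidProd, ← cs.prod_map_pairEnd hω]
  rfl

theorem posLift_pairAct (w : W) (x : W × M.ArtinTitsMonoid) :
    cs.posLift (cs.pairAct w x).1 * (cs.pairAct w x).2 =
      cs.posLift w * (cs.posLift x.1 * x.2) := by
  rw [pairAct, posLift_mul _ (isPrefix_mul.1 (cs.isPrefix_mul_absorb w x.1)),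
    (cs.absorb_isPrefix w x.1).posLift_eq]
  simp [mul_assoc]

theorem posLift_pairHom (a : M.ArtinTitsMonoid) :
    cs.posLift (cs.pairHom a (1, 1)).1 * (cs.pairHom a (1, 1)).2 = a := by
  induction a using monoid_induction with
  | one =>
    rw [map_one]
    change cs.posLift 1 * 1 = 1
    simp
  | gen_mul i a ih =>
    rw [map_mul]
    change cs.posLift (cs.pairAct (cs.simple i) (cs.pairHom a (1, 1))).1 * _ = _
    refine (cs.posLift_pairAct _ _).trans ?_
    rw [ih, posLift_simple]

/-- The lift of the longest element is left cancellable, since its action only shifts normal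
forms. -/
theorem posLift_longest_cancel {a b : M.ArtinTitsMonoid}
    (h : cs.posLift cs.longest * a = cs.posLift cs.longest * b) : a = b := by
  have key : ∀ a, (cs.pairHom (cs.posLift cs.longest * a) (1, 1)).2 = a := by
    intro a
    rw [map_mul, pairHom_posLift]
    change (cs.pairAct cs.longest (cs.pairHom a (1, 1))).2 = a
    rw [pairAct_longest]
    exact cs.posLift_pairHom a
  rw [← key a, h, key]

include cs in
theorem monoid_mul_left_cancel {a b c : M.ArtinTitsMonoid} (h : a * b = a * c) : b = c := by
  induction a using monoid_induction with
  | one => simpa using h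
  | gen_mul i a ih =>
    rw [mul_assoc, mul_assoc] at h
    apply ih
    apply cs.posLift_longest_cancel
    -- Each generator divides the lift of the longest element on the right.
    have h1 : cs.posLift cs.longest = cs.posLift (cs.longest * cs.simple i) * M.monoidGen i := by
      simpa using (cs.isPrefix_longest (cs.longest * cs.simple i)).posLift_eq
    rw [h1, mul_assoc, h, mul_assoc]

include cs in
/-- If two generators divide `g` on the left, so does their braid. -/
theorem exists_eq_braidWord_mul {g a b : M.ArtinTitsMonoid} {i j : B} (hij : i ≠ j)
    (hi : g = M.monoidGen i * a) (hj : g = M.monoidGen j * b) :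
    ∃ y, g = M.monoidProd (braidWord M i j).reverse * y := by
  have key : ∀ k c, g = M.monoidGen k * c → cs.IsPrefix (cs.simple k) (cs.pairHom g (1, 1)).1 := by
    rintro k c rfl
    rw [map_mul]
    exact cs.isPrefix_mul_absorb _ _
  obtain ⟨hred, -, hb⟩ := cs.isPrefix_braidWord hij (key i a hi) (key j b hj)
  refine ⟨cs.posLift ((cs.wordProd (braidWord M i j).reverse)⁻¹ * (cs.pairHom g (1, 1)).1) *
    (cs.pairHom g (1, 1)).2, ?_⟩
  rw [← cs.posLift_wordProd hred, ← mul_assoc, ← hb.posLift_eq, posLift_pairHom]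

end CoxeterSystem

namespace CoxeterMatrix

open CoxeterSystem

variable {B : Type*} {M : CoxeterMatrix B} [Finite M.Group]

instance : IsCancelMul M.ArtinTitsMonoid where
  mul_left_cancel _ _ _ h := M.toCoxeterSystem.monoid_mul_left_cancel h
  mul_right_cancel a b c h := by
    have h' := congrArg rev h
    simp only [rev_mul] at h'
    rw [← rev_rev b, M.toCoxeterSystem.monoid_mul_left_cancel h', rev_rev]

/-! ### Embedding the monoid into the group -/

/-- A standard parabolic submonoid has a central element that is divisible by each generator of the
submonoid, namely the square of the lift of a longest element. -/
theorem exists_central (M : CoxeterMatrix B) [Finite M.Group] (X : Set B) :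
    ∃ z ∈ M.monoidParabolic X, ∀ i ∈ X, M.monoidGen i * z = z * M.monoidGen i ∧
      ∃ y ∈ M.monoidParabolic X, z = M.monoidGen i * y := by
  let cs := M.toCoxeterSystem
  obtain ⟨m, hm, hmax⟩ := cs.exists_isPrefix_max X
  obtain ⟨hmm, hconj⟩ := cs.mul_self_and_conj_of_isPrefix_max hm hmax
  have hmX := cs.posLift_mem_monoidParabolic hm
  refine ⟨cs.posLift m * cs.posLift m, mul_mem hmX hmX, fun i hi => ⟨?_, ?_⟩⟩
  · obtain ⟨j, hj⟩ := hconj i hi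
    have hj' : m * cs.simple j = cs.simple i * m := by
      have := congrArg (fun x => m * x * m) hj
      simp only [mul_assoc, hmm, mul_one] at this
      rw [← this, ← mul_assoc, hmm, one_mul]
    rw [← mul_assoc, ← cs.posLift_mul_gen hj', mul_assoc, ← cs.posLift_mul_gen hj, mul_assoc]
  · have h := (hmax _ (Subgroup.subset_closure ⟨i, hi, rfl⟩)).posLift_eq
    rw [posLift_simple] at h
    have hy := hmX
    rw [h, mul_mem_monoidParabolic] at hy
    exact ⟨_, mul_mem hy.2 hmX, by rw [← mul_assoc, ← h]⟩

/-- The Artin–Tits monoid of spherical type embeds into the Artin–Tits group: it embeds into its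
localization at a central element, which is a group because this element is divisible by all
generators. -/
theorem monoidToGroup_injective : Function.Injective M.monoidToGroup := by
  obtain ⟨z, -, hz⟩ := M.exists_central Set.univ
  have hcomm : ∀ a, a * z = z * a := by
    intro a
    induction a using monoid_induction with
    | one => simp
    | gen_mul i a ih => rw [mul_assoc, ih, ← mul_assoc, (hz i trivial).1, mul_assoc]
  have hS : ∀ (s : Submonoid.powers z) (a : M.ArtinTitsMonoid), (s : M.ArtinTitsMonoid) * a = a * s
      := by
    rintro ⟨_, n, rfl⟩ a
    exact (Commute.pow_right (hcomm a) n).eq.symm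
  let _ : OreLocalization.OreSet (Submonoid.powers z) :=
    { ore_right_cancel := fun r₁ r₂ s h => ⟨1, by rw [mul_right_cancel h]⟩
      oreNum := fun r _ => r
      oreDenom := fun _ s => s
      ore_eq := fun r s => hS s r }
  let ι := OreLocalization.numeratorHom (R := M.ArtinTitsMonoid) (S := Submonoid.powers z)
  have hι : Function.Injective ι := by
    intro a b h
    obtain ⟨u, v, h1, h2⟩ := OreLocalization.oreDiv_eq_iff.1 h
    simp only [OneMemClass.coe_one, mul_one] at h2
    rw [← h2] at h1
    exact (mul_left_cancel h1).symm
  have hunit : ∀ i, IsUnit (ι (M.monoidGen i)) := by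
    intro i
    obtain ⟨hc, y, -, hy⟩ := hz i trivial
    have hcy : Commute (M.monoidGen i) y := by
      rw [hy, mul_assoc] at hc
      exact mul_left_cancel hc
    have hzu : IsUnit (ι z) :=
      OreLocalization.numerator_isUnit (⟨z, Submonoid.mem_powers z⟩ : Submonoid.powers z)
    rw [show ι z = _ from congrArg ι hy, map_mul, (hcy.map ι).isUnit_mul_iff] at hzu
    exact hzu.1
  let f : B → (OreLocalization (Submonoid.powers z) M.ArtinTitsMonoid)ˣ := fun i => (hunit i).unit
  have hf : ∀ ω : List B, (((ω.map f).prod : Units _) : OreLocalization (Submonoid.powers z)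
      M.ArtinTitsMonoid) = ι (M.monoidProd ω) := by
    intro ω
    induction ω with
    | nil => simp
    | cons i ω ih =>
      rw [List.map_cons, List.prod_cons, Units.val_mul, ih, monoidProd_cons, map_mul]
      rfl
  have hrel : ∀ r ∈ M.braidRelationsSet, FreeGroup.lift f r = 1 := by
    rintro _ ⟨i, j, hij, hM, rfl⟩
    have e : (FreeGroup.lift f : FreeGroup B → _) ∘ FreeGroup.of = f := by
      funext i; simp
    rw [map_mul, map_inv, map_list_prod, map_list_prod, mul_inv_eq_one, List.map_map, List.map_map,
      e]
    ext
    rw [hf, hf, M.monoidProd_braidWord hij hM]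
  have hcomp : ∀ a, ((PresentedGroup.toGroup hrel (M.monoidToGroup a) : Units _) :
      OreLocalization (Submonoid.powers z) M.ArtinTitsMonoid) = ι a := by
    intro a
    induction a using monoid_induction with
    | one => simp
    | gen_mul i a ih =>
      rw [map_mul, map_mul, Units.val_mul, ih, map_mul, monoidToGroup_gen, artinGen,
        PresentedGroup.toGroup.of]
      rfl
  intro a b h
  apply hι
  rw [← hcomp, h, hcomp]

end CoxeterMatrix

namespace CoxeterMatrix

open CoxeterSystem

variable {B : Type*} {M : CoxeterMatrix B}

/-! ### Division by parabolic submonoids -/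

theorem monoidProd_mem_monoidParabolic {X : Set B} {ω : List B} (h : ∀ i ∈ ω, i ∈ X) :
    M.monoidProd ω ∈ M.monoidParabolic X := by
  induction ω with
  | nil => simp
  | cons i ω ih =>
    rw [monoidProd_cons, mul_mem_monoidParabolic, gen_mem_monoidParabolic]
    exact ⟨h i (by simp), ih fun j hj => h j (by simp [hj])⟩

/-- Every positive element has a right factor in the parabolic submonoid of `X` such that the left
factor is not divisible on the right by generators from `X`. -/
theorem exists_eq_mul_reduced (X : Set B) (g : M.ArtinTitsMonoid) :
    ∃ h a, g = h * a ∧ a ∈ M.monoidParabolic X ∧ ∀ x ∈ X, ∀ k, h ≠ k * M.monoidGen x := by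
  induction hn : len g using Nat.strong_induction_on generalizing g with
  | _ n ih =>
    by_cases hg : ∃ x ∈ X, ∃ k, g = k * M.monoidGen x
    · obtain ⟨x, hx, k, rfl⟩ := hg
      obtain ⟨h, a, rfl, ha, hh⟩ := ih (len k) (by rw [← hn]; simp) k rfl
      exact ⟨h, a * M.monoidGen x, mul_assoc _ _ _,
        mul_mem ha (gen_mem_monoidParabolic.2 hx), hh⟩
    · push Not at hg
      exact ⟨g, 1, by simp, one_mem _, hg⟩

variable [Finite M.Group]

/-- If no generator from `X` divides `h` on the left, then the left divisors of `d * h` in the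
parabolic submonoid of `X`, where `d` lies in this submonoid, are the left divisors of `d`. -/
theorem exists_eq_mul_of_mul_eq_mul_reduced {X : Set B} {h : M.ArtinTitsMonoid}
    (hh : ∀ x ∈ X, ∀ k, h ≠ M.monoidGen x * k) {d : M.ArtinTitsMonoid}
    (hd : d ∈ M.monoidParabolic X) {c k : M.ArtinTitsMonoid} (hc : c ∈ M.monoidParabolic X)
    (hck : c * k = d * h) : ∃ e, d = c * e := by
  induction hn : len d using Nat.strong_induction_on generalizing d c k with
  | _ n ih =>
    by_cases hc1 : c = 1
    · exact ⟨d, by rw [hc1, one_mul]⟩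
    obtain ⟨y, c, rfl⟩ := M.exists_eq_gen_mul hc1
    rw [mul_mem_monoidParabolic, gen_mem_monoidParabolic] at hc
    by_cases hd1 : d = 1
    · rw [hd1, one_mul, mul_assoc] at hck
      exact absurd hck.symm (hh y hc.1 _)
    -- It suffices that the first letter `y` of `c` divides `d`.
    suffices ∃ d', d = M.monoidGen y * d' by
      obtain ⟨d', rfl⟩ := this
      rw [mul_mem_monoidParabolic] at hd
      rw [mul_assoc, mul_assoc] at hck
      obtain ⟨e, rfl⟩ := ih (len d') (by rw [← hn]; simp) hd.2 hc.2 (mul_left_cancel hck) rfl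
      exact ⟨e, (mul_assoc _ _ _).symm⟩
    obtain ⟨x, d, rfl⟩ := M.exists_eq_gen_mul hd1
    rw [mul_mem_monoidParabolic, gen_mem_monoidParabolic] at hd
    by_cases hxy : x = y
    · exact ⟨d, by rw [hxy]⟩
    obtain ⟨q, hq⟩ := M.toCoxeterSystem.exists_eq_braidWord_mul (Ne.symm hxy)
      (hck.symm.trans (mul_assoc _ _ _)) (mul_assoc _ _ _)
    have hM := M.toCoxeterSystem.coxeterMatrix_ne_zero y x
    have hβX : M.monoidProd (braidWord M y x).reverse ∈ M.monoidParabolic X := by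
      refine monoidProd_mem_monoidParabolic fun i hi => ?_
      rw [List.mem_reverse, M.mem_braidWord (Ne.symm hxy) hM] at hi
      rcases hi with rfl | rfl
      · exact hc.1
      · exact hd.1
    have hβ := M.monoidProd_braidWord_reverse (Ne.symm hxy) hM
    obtain ⟨β, hβx⟩ := exists_braidWord_reverse_eq_cons hM
    obtain ⟨β', hβy⟩ := exists_braidWord_reverse_eq_cons (M.symmetric y x ▸ hM)
    rw [hβx, monoidProd_cons] at hβX hq hβ
    rw [hβy, monoidProd_cons] at hβ
    rw [mul_mem_monoidParabolic] at hβX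
    rw [mul_assoc, mul_assoc] at hq
    obtain ⟨e, rfl⟩ := ih (len d) (by rw [← hn]; simp) hd.2 hβX.2 (mul_left_cancel hq).symm rfl
    exact ⟨M.monoidProd β' * e, by rw [← mul_assoc, hβ, mul_assoc]⟩

/-- The mirror image of `exists_eq_mul_of_mul_eq_mul_reduced`. -/
theorem exists_eq_mul_of_mul_eq_reduced_mul {X : Set B} {h : M.ArtinTitsMonoid}
    (hh : ∀ x ∈ X, ∀ k, h ≠ k * M.monoidGen x) {d : M.ArtinTitsMonoid}
    (hd : d ∈ M.monoidParabolic X) {c k : M.ArtinTitsMonoid} (hc : c ∈ M.monoidParabolic X)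
    (hck : k * c = h * d) : ∃ e, d = e * c := by
  have hh' : ∀ x ∈ X, ∀ k, rev h ≠ M.monoidGen x * k := by
    intro x hx k hk
    apply hh x hx (rev k)
    rw [← rev_rev h, hk, rev_mul, rev_gen]
  obtain ⟨e, he⟩ := exists_eq_mul_of_mul_eq_mul_reduced hh' (rev_mem_monoidParabolic.2 hd)
    (rev_mem_monoidParabolic.2 hc) (k := rev k) (by rw [← rev_mul, hck, rev_mul])
  exact ⟨rev e, by rw [← rev_rev d, he, rev_mul, rev_rev]⟩

/-! ### Normalizers of parabolic subgroups -/

/-- Every element of a parabolic subgroup becomes positive after multiplication by a suitable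
positive element that is central in the subgroup. -/
theorem exists_central_mul_eq {X : Set B} {a : M.ArtinTitsGroup} (ha : a ∈ M.artinParabolic X) :
    ∃ c ∈ M.monoidParabolic X, ∃ d ∈ M.monoidParabolic X,
      (∀ b ∈ M.artinParabolic X, Commute b (M.monoidToGroup c)) ∧
        M.monoidToGroup c * a = M.monoidToGroup d := by
  obtain ⟨z, hzX, hz⟩ := M.exists_central X
  have hcomm : ∀ b ∈ M.artinParabolic X, Commute b (M.monoidToGroup z) := by
    have h : M.artinParabolic X ≤ Subgroup.centralizer {M.monoidToGroup z} := by
      refine (Subgroup.closure_le _).2 ?_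
      rintro _ ⟨i, hi, rfl⟩
      rw [SetLike.mem_coe, Subgroup.mem_centralizer_singleton_iff, ← monoidToGroup_gen, ← map_mul,
        ← map_mul, (hz i hi).1]
    intro b hb
    exact Subgroup.mem_centralizer_singleton_iff.1 (h hb)
  suffices ∃ n : ℕ, ∃ d ∈ M.monoidParabolic X, M.monoidToGroup (z ^ n) * a = M.monoidToGroup d by
    obtain ⟨n, d, hd, h⟩ := this
    exact ⟨z ^ n, pow_mem hzX n, d, hd,
      fun b hb => by rw [map_pow]; exact (hcomm b hb).pow_right n, h⟩
  induction ha using Subgroup.closure_induction_right with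
  | one => exact ⟨0, 1, one_mem _, by simp⟩
  | mul_right a ha _ hs ih =>
    obtain ⟨i, hi, rfl⟩ := hs
    obtain ⟨n, d, hd, h⟩ := ih
    refine ⟨n, d * M.monoidGen i, mul_mem hd (gen_mem_monoidParabolic.2 hi), ?_⟩
    rw [← mul_assoc, h, map_mul, monoidToGroup_gen]
  | mul_inv_cancel a ha _ hs ih =>
    obtain ⟨i, hi, rfl⟩ := hs
    obtain ⟨n, d, hd, h⟩ := ih
    obtain ⟨hzi, y, hy, hzy⟩ := hz i hi
    have hzy' : z = y * M.monoidGen i := by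
      rw [hzy, mul_assoc] at hzi
      exact hzy.trans (mul_left_cancel hzi)
    refine ⟨n + 1, d * y, mul_mem hd hy, ?_⟩
    have h1 : M.monoidToGroup z * (M.artinGen i)⁻¹ = M.monoidToGroup y := by
      rw [hzy', map_mul, monoidToGroup_gen, mul_inv_cancel_right]
    rw [pow_succ, map_mul, mul_assoc, ← mul_assoc (M.monoidToGroup z), ← (hcomm a ha).eq,
      mul_assoc a, h1, ← mul_assoc, h, map_mul]

theorem artinParabolic_univ (M : CoxeterMatrix B) : M.artinParabolic Set.univ = ⊤ := by
  rw [artinParabolic, Set.image_univ]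
  exact PresentedGroup.closure_range_of _

/-- A positive element `h` that normalizes the parabolic subgroup of `X`, and that is not divisible
on the right by generators from `X`, permutes the generators from `X`. -/
theorem exists_mul_gen_eq_of_reduced {X : Set B} {h : M.ArtinTitsMonoid}
    (hN : M.monoidToGroup h ∈ Subgroup.normalizer (M.artinParabolic X : Set M.ArtinTitsGroup))
    (hh : ∀ x ∈ X, ∀ k, h ≠ k * M.monoidGen x) :
    ∀ x ∈ X, ∃ y ∈ X, h * M.monoidGen x = M.monoidGen y * h := by
  have hgen : ∀ x ∈ X, M.artinGen x ∈ M.artinParabolic X :=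
    fun x hx => Subgroup.subset_closure ⟨x, hx, rfl⟩
  -- No generator `x` from `X` divides `h = x k` on the left: as `h` normalizes the subgroup, `k`
  -- lies in `h A_X`, so that reducedness on the right makes `k` a positive multiple of `h`, in
  -- contradiction to its length.
  have hl : ∀ x ∈ X, ∀ k, h ≠ M.monoidGen x * k := by
    rintro x hx k hk
    have ha : (M.monoidToGroup h)⁻¹ * M.artinGen x * M.monoidToGroup h ∈ M.artinParabolic X := by
      have := (Subgroup.mem_normalizer_iff.1 (inv_mem hN) (M.artinGen x)).1 (hgen x hx)
      simpa using this
    obtain ⟨c, hc, d, hd, hcomm, hcd⟩ := exists_central_mul_eq (inv_mem ha)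
    have e : M.monoidToGroup (k * c) = M.monoidToGroup (h * d) := by
      rw [map_mul, map_mul, ← hcd, ← (hcomm _ (inv_mem ha)).eq]
      have hk' : M.monoidToGroup h = M.artinGen x * M.monoidToGroup k := by
        rw [hk, map_mul, monoidToGroup_gen]
      rw [← mul_assoc]
      congr 1
      rw [mul_inv_rev, mul_inv_rev, inv_inv, mul_inv_cancel_left, eq_inv_mul_iff_mul_eq]
      exact hk'.symm
    obtain ⟨e', he'⟩ := exists_eq_mul_of_mul_eq_reduced_mul hh hd hc (monoidToGroup_injective e)
    rw [he', ← mul_assoc] at e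
    have hke := mul_right_cancel (monoidToGroup_injective e)
    have h1 := congrArg len hke
    have h2 := congrArg len hk
    rw [len_mul] at h1 h2
    rw [len_gen] at h2
    omega
  intro x hx
  have hb := (Subgroup.mem_normalizer_iff.1 hN (M.artinGen x)).1 (hgen x hx)
  -- The denominator `c` of `h x h⁻¹ = c⁻¹ d` divides `d * h`, hence `d`.
  obtain ⟨c, hc, d, hd, -, hcd⟩ := exists_central_mul_eq hb
  have e : c * (h * M.monoidGen x) = d * h := by
    apply monoidToGroup_injective
    simp only [map_mul, ← hcd, monoidToGroup_gen]
    group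
  obtain ⟨d', rfl⟩ := exists_eq_mul_of_mul_eq_mul_reduced hl hd hc e
  rw [mul_assoc] at e
  have e' := mul_left_cancel e
  have hlen := congrArg len e'
  rw [len_mul, len_mul, len_gen] at hlen
  obtain ⟨y, rfl⟩ := M.exists_eq_gen_of_len (a := d') (by omega)
  rw [mul_mem_monoidParabolic, gen_mem_monoidParabolic] at hd
  exact ⟨y, hd.2, e'⟩

/-- Up to right multiplication by elements of the parabolic subgroup of `X`, every element of its
normalizer permutes the generators from `X`. -/
theorem exists_mul_artinGen_eq {X : Set B} {g : M.ArtinTitsGroup}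
    (hg : g ∈ Subgroup.normalizer (M.artinParabolic X : Set M.ArtinTitsGroup)) :
    ∃ a ∈ M.artinParabolic X, ∀ x ∈ X, ∃ y ∈ X, g * a * M.artinGen x = M.artinGen y * (g * a) := by
  obtain ⟨c, -, d, -, hcomm, hcd⟩ :=
    exists_central_mul_eq (X := Set.univ) (a := g) (by rw [artinParabolic_univ]; trivial)
  replace hcomm : ∀ b, Commute b (M.monoidToGroup c) :=
    fun b => hcomm b (by rw [artinParabolic_univ]; trivial)
  obtain ⟨h, a, rfl, ha, hh⟩ := exists_eq_mul_reduced X d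
  have haX := inv_mem (monoidToGroup_mem_artinParabolic ha)
  have hh' : M.monoidToGroup h = M.monoidToGroup c * (g * (M.monoidToGroup a)⁻¹) := by
    rw [← mul_assoc, hcd, map_mul, mul_inv_cancel_right]
  have hcN : M.monoidToGroup c ∈
      Subgroup.normalizer (M.artinParabolic X : Set M.ArtinTitsGroup) := by
    rw [Subgroup.mem_normalizer_iff]
    intro b
    rw [← (hcomm b).eq, mul_inv_cancel_right]
  refine ⟨_, haX, fun x hx => ?_⟩
  obtain ⟨y, hy, hxy⟩ := exists_mul_gen_eq_of_reduced
    (by rw [hh']; exact mul_mem hcN (mul_mem hg (Subgroup.le_normalizer haX))) hh x hx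
  have e := congrArg M.monoidToGroup hxy
  rw [map_mul, map_mul, monoidToGroup_gen, monoidToGroup_gen, hh',
    mul_assoc (M.monoidToGroup c), ← mul_assoc (M.artinGen y), (hcomm (M.artinGen y)).eq,
    mul_assoc (M.monoidToGroup c), mul_left_cancel_iff] at e
  exact ⟨y, hy, e⟩

end CoxeterMatrix

namespace CoxeterSystem

variable {B W : Type*} [Group W] {M : CoxeterMatrix B} (cs : CoxeterSystem M W)

/-- An element of minimal length in its right coset of a parabolic subgroup has lengths adding with
the elements of the subgroup. -/
theorem length_mul_of_forall_le {X : Set B} {w : W}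
    (hw : ∀ u ∈ Subgroup.closure (cs.simple '' X), cs.length w ≤ cs.length (u * w)) {u : W}
    (hu : u ∈ Subgroup.closure (cs.simple '' X)) :
    cs.length (u * w) = cs.length u + cs.length w := by
  have step : ∀ u ∈ Subgroup.closure (cs.simple '' X), ∀ i ∈ X,
      cs.length (u * w) = cs.length u + cs.length w →
      cs.length (cs.simple i * u * w) = cs.length (cs.simple i * u) + cs.length w := by
    intro u hu i hi h
    have h1 := cs.length_simple_mul u i
    have h2 := cs.length_simple_mul (u * w) i
    have h3 := cs.length_mul_le (cs.simple i * u) w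
    rw [← mul_assoc] at h2
    by_contra hne
    have hinv : cs.IsLeftInversion (u * w) (cs.simple i) :=
      ⟨cs.isReflection_simple i, by rw [← mul_assoc]; omega⟩
    rcases hinv.mul with h' | h'
    · have := h'.2
      omega
    · have := hw _ (mul_mem (mul_mem (inv_mem hu) (Subgroup.subset_closure ⟨i, hi, rfl⟩)) hu)
      exact absurd h'.2 (by omega)
  induction hu using Subgroup.closure_induction_left with
  | one => simp
  | mul_left _ hs u hu h =>
    obtain ⟨i, hi, rfl⟩ := hs
    exact step u hu i hi h
  | inv_mul_cancel _ hs u hu h =>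
    obtain ⟨i, hi, rfl⟩ := hs
    rw [inv_simple]
    exact step u hu i hi h

/-- Up to right multiplication by elements of the parabolic subgroup of `X`, every element of its
normalizer permutes the simple generators from `X`. -/
theorem exists_mul_simple_eq [Finite W] {X : Set B} {w : W}
    (hw : w ∈ Subgroup.normalizer (Subgroup.closure (cs.simple '' X) : Set W)) :
    ∃ u ∈ Subgroup.closure (cs.simple '' X), ∀ x ∈ X, ∃ y ∈ X,
      w * u * cs.simple x = cs.simple y * (w * u) := by
  have hgen : ∀ x ∈ X, cs.simple x ∈ Subgroup.closure (cs.simple '' X) :=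
    fun x hx => Subgroup.subset_closure ⟨x, hx, rfl⟩
  obtain ⟨u, hu, hmin⟩ := Set.exists_min_image
    (Subgroup.closure (cs.simple '' X) : Set W) (fun u => cs.length (w * u)) (Set.toFinite _)
    ⟨1, one_mem _⟩
  have hwu := mul_mem hw (Subgroup.le_normalizer hu)
  refine ⟨u, hu, fun x hx => ?_⟩
  have hleft : ∀ v ∈ Subgroup.closure (cs.simple '' X),
      cs.length (w * u) ≤ cs.length (v * (w * u)) := by
    intro v hv
    have h1 := (Subgroup.mem_normalizer_iff.1 (inv_mem hw) v).1 hv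
    have e : v * (w * u) = w * (w⁻¹ * v * w⁻¹⁻¹ * u) := by group
    rw [e]
    exact hmin _ (mul_mem h1 hu)
  have hyX := (Subgroup.mem_normalizer_iff.1 hwu (cs.simple x)).1 (hgen x hx)
  have h1 := cs.length_mul_of_forall_le hleft hyX
  rw [inv_mul_cancel_right] at h1
  have h2 := cs.length_mul_simple (w * u) x
  have h3 := hmin _ (mul_mem hu (hgen x hx))
  simp only [← mul_assoc] at h3
  obtain ⟨y, hy⟩ := cs.length_eq_one_iff.1
    (show cs.length (w * u * cs.simple x * (w * u)⁻¹) = 1 by omega)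
  refine ⟨y, ?_, by rw [← hy, inv_mul_cancel_right]⟩
  have := cs.posLift_mem_monoidParabolic hyX
  rwa [hy, posLift_simple, CoxeterMatrix.gen_mem_monoidParabolic] at this

end CoxeterSystem

theorem Subgroup.mem_normalizer_closure_of_finite {G : Type*} [Group G] {T : Set G} (hT : T.Finite)
    {g : G} (h : ∀ t ∈ T, g * t * g⁻¹ ∈ T) : g ∈ normalizer (closure T : Set G) := by
  have himg : MulAut.conj g '' T = T :=
    Set.eq_of_subset_of_ncard_le (by rintro _ ⟨t, ht, rfl⟩; exact h t ht)
      (Set.ncard_image_of_injective T (MulAut.conj g).injective).ge hT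
  have hmap : (closure T).map (MulAut.conj g).toMonoidHom = closure T := by
    rw [MonoidHom.map_closure]
    exact congrArg _ himg
  rw [mem_normalizer_iff]
  intro x
  nth_rw 2 [← hmap]
  exact (Subgroup.mem_map_equiv (f := MulAut.conj g)).trans (by simp [mul_assoc]) |>.symm

/-! ### Comparison with the normalizers in the Coxeter group -/

namespace CoxeterMatrix

open CoxeterSystem

variable {B : Type*} (M : CoxeterMatrix B)

theorem map_artinParabolic (X : Set B) :
    (M.artinParabolic X).map M.artinToCoxeter = M.coxeterParabolic X := by
  rw [artinParabolic, coxeterParabolic, MonoidHom.map_closure, Set.image_image]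
  simp only [artinToCoxeter_artinGen]

theorem artinToCoxeter_mem_coxeterParabolic {X : Set B} {a : M.ArtinTitsGroup}
    (ha : a ∈ M.artinParabolic X) : M.artinToCoxeter a ∈ M.coxeterParabolic X := by
  rw [← map_artinParabolic]
  exact Subgroup.mem_map_of_mem _ ha

theorem artinToCoxeter_mem_normalizer {X : Set B} {g : M.ArtinTitsGroup}
    (hg : g ∈ Subgroup.normalizer (M.artinParabolic X : Set M.ArtinTitsGroup)) :
    M.artinToCoxeter g ∈ Subgroup.normalizer (M.coxeterParabolic X : Set M.Group) := by
  have := Subgroup.le_normalizer_map M.artinToCoxeter (Subgroup.mem_map_of_mem _ hg)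
  rwa [map_artinParabolic] at this

theorem artinToCoxeter_mem_centralizer {X : Set B} {g : M.ArtinTitsGroup}
    (hg : g ∈ Subgroup.centralizer (M.artinParabolic X : Set M.ArtinTitsGroup)) :
    M.artinToCoxeter g ∈ Subgroup.centralizer (M.coxeterParabolic X : Set M.Group) := by
  rw [Subgroup.mem_centralizer_iff] at *
  rw [← map_artinParabolic]
  rintro _ ⟨a, ha, rfl⟩
  rw [← map_mul, ← map_mul, hg a ha]

variable [Finite M.Group]

/-- The lift of a Coxeter group to its Artin–Tits group; it is a section of the projection, but not
a homomorphism. -/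
noncomputable def groupLift (w : M.Group) : M.ArtinTitsGroup :=
  M.monoidToGroup (M.toCoxeterSystem.posLift w)

theorem artinToCoxeter_groupLift (w : M.Group) : M.artinToCoxeter (M.groupLift w) = w := by
  obtain ⟨ω, hω, rfl⟩ := M.toCoxeterSystem.exists_isReduced w
  rw [groupLift, posLift_wordProd _ hω, ← MonoidHom.comp_apply, map_monoidProd, wordProd,
    toCoxeterSystem_simple]
  congr 2

variable {M}

theorem groupLift_mul_artinGen {w : M.Group} {i j : B} (h : w * M.simple i = M.simple j * w) :
    M.groupLift w * M.artinGen i = M.artinGen j * M.groupLift w := by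
  rw [groupLift, ← monoidToGroup_gen, ← monoidToGroup_gen, ← map_mul, ← map_mul,
    posLift_mul_gen _ (by simpa using h)]

theorem groupLift_mem_artinParabolic {X : Set B} {u : M.Group} (hu : u ∈ M.coxeterParabolic X) :
    M.groupLift u ∈ M.artinParabolic X :=
  monoidToGroup_mem_artinParabolic <| M.toCoxeterSystem.posLift_mem_monoidParabolic <| by
    rwa [toCoxeterSystem_simple]

/-- Surjectivity: the normalizer of the parabolic subgroup of the Artin–Tits group maps onto that of
the Coxeter group. -/
theorem exists_artinToCoxeter_eq_of_mem_normalizer [Finite B] {X : Set B} {w : M.Group}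
    (hw : w ∈ Subgroup.normalizer (M.coxeterParabolic X : Set M.Group)) :
    ∃ g ∈ Subgroup.normalizer (M.artinParabolic X : Set M.ArtinTitsGroup),
      M.artinToCoxeter g = w := by
  obtain ⟨u, hu, h⟩ := M.toCoxeterSystem.exists_mul_simple_eq (X := X) (w := w)
    (by rwa [toCoxeterSystem_simple])
  rw [toCoxeterSystem_simple] at hu h
  refine ⟨M.groupLift (w * u) * M.groupLift u⁻¹, mul_mem ?_ (Subgroup.le_normalizer
    (groupLift_mem_artinParabolic (inv_mem hu))), by simp [artinToCoxeter_groupLift]⟩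
  refine Subgroup.mem_normalizer_closure_of_finite (Set.toFinite _) ?_
  rintro _ ⟨x, hx, rfl⟩
  obtain ⟨y, hy, hxy⟩ := h x hx
  rw [groupLift_mul_artinGen hxy, mul_inv_cancel_right]
  exact ⟨y, hy, rfl⟩

/-- Injectivity: an element of the normalizer that acts on the parabolic subgroup like an inner
automorphism after projection to the Coxeter group does so already in the Artin–Tits group. -/
theorem artinToCoxeter_mem_centralizerMulSelf_iff {X : Set B} {g : M.ArtinTitsGroup}
    (hg : g ∈ Subgroup.normalizer (M.artinParabolic X : Set M.ArtinTitsGroup)) :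
    M.artinToCoxeter g ∈ (M.coxeterParabolic X).centralizerMulSelf ↔
      g ∈ (M.artinParabolic X).centralizerMulSelf := by
  rw [Subgroup.mem_centralizerMulSelf, Subgroup.mem_centralizerMulSelf]
  constructor
  · rintro ⟨z, hz, u, hu, hzu⟩
    obtain ⟨a, ha, hperm⟩ := exists_mul_artinGen_eq hg
    -- Modulo the parabolic subgroup, `g` and `v` induce the same permutation of the generators.
    obtain ⟨v, hv_def⟩ : ∃ v, v = u * M.artinToCoxeter a := ⟨_, rfl⟩
    have hv : v ∈ M.coxeterParabolic X :=
      hv_def ▸ mul_mem hu (M.artinToCoxeter_mem_coxeterParabolic ha)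
    have hvA := groupLift_mem_artinParabolic hv
    have hgv : M.artinToCoxeter (g * a) = z * v := by rw [map_mul, ← hzu, mul_assoc, hv_def]
    have hζ : (M.groupLift v)⁻¹ * (g * a) ∈
        Subgroup.centralizer (M.artinParabolic X : Set M.ArtinTitsGroup) := by
      rw [artinParabolic, Subgroup.centralizer_closure, Subgroup.mem_centralizer_iff]
      rintro _ ⟨x, hx, rfl⟩
      obtain ⟨y, hy, hxy⟩ := hperm x hx
      have hw := congrArg M.artinToCoxeter hxy
      rw [map_mul _ (g * a), map_mul _ (M.artinGen y), hgv, artinToCoxeter_artinGen,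
        artinToCoxeter_artinGen, ← mul_assoc,
        Subgroup.mem_centralizer_iff.1 hz (M.simple y) (Subgroup.subset_closure ⟨y, hy, rfl⟩),
        mul_assoc, mul_assoc, mul_left_cancel_iff] at hw
      have hv' := groupLift_mul_artinGen hw
      rw [mul_assoc _ (g * a), hxy, ← mul_assoc, ← mul_assoc _ (M.artinGen y)]
      congr 1
      rw [eq_inv_mul_iff_mul_eq, ← mul_assoc, hv', mul_inv_cancel_right]
    refine ⟨_, hζ, M.groupLift v * a⁻¹, mul_mem hvA (inv_mem ha), ?_⟩
    rw [← mul_assoc, ← Subgroup.mem_centralizer_iff.1 hζ _ hvA]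
    group
  · rintro ⟨z, hz, a, ha, rfl⟩
    exact ⟨_, M.artinToCoxeter_mem_centralizer hz, _, M.artinToCoxeter_mem_coxeterParabolic ha,
      (map_mul _ _ _).symm⟩

end CoxeterMatrix

theorem mainTheorem4 {B : Type*} [Finite B] (M : CoxeterMatrix B) [Finite M.Group] (X : Set B) :
    ∃ e : (M.artinParabolic X).NormalizerQuotient ≃* (M.coxeterParabolic X).NormalizerQuotient,
      ∀ g : Subgroup.normalizer (M.artinParabolic X : Set M.ArtinTitsGroup),
        ∃ w : Subgroup.normalizer (M.coxeterParabolic X : Set M.Group),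
          (w : M.Group) = M.artinToCoxeter g ∧
            e (QuotientGroup.mk g) = QuotientGroup.mk w := by
  let φ : Subgroup.normalizer (M.artinParabolic X : Set M.ArtinTitsGroup) →*
      Subgroup.normalizer (M.coxeterParabolic X : Set M.Group) :=
    (M.artinToCoxeter.comp (Subgroup.subtype _)).codRestrict _
      fun g => M.artinToCoxeter_mem_normalizer g.2
  let N := (M.coxeterParabolic X).centralizerMulSelf.subgroupOf
    (Subgroup.normalizer (M.coxeterParabolic X : Set M.Group))
  let ψ := (QuotientGroup.mk' N).comp φ
  have hψ : Function.Surjective ψ := by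
    refine QuotientGroup.mk_surjective.comp ?_
    rintro ⟨w, hw⟩
    obtain ⟨g, hg, rfl⟩ := CoxeterMatrix.exists_artinToCoxeter_eq_of_mem_normalizer hw
    exact ⟨⟨g, hg⟩, rfl⟩
  have hker : (M.artinParabolic X).centralizerMulSelf.subgroupOf
      (Subgroup.normalizer (M.artinParabolic X : Set M.ArtinTitsGroup)) = ψ.ker := by
    ext g
    rw [Subgroup.mem_subgroupOf, ← CoxeterMatrix.artinToCoxeter_mem_centralizerMulSelf_iff g.2,
      MonoidHom.mem_ker]
    exact (QuotientGroup.eq_one_iff (N := N) (φ g)).symm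
  exact ⟨(QuotientGroup.quotientMulEquivOfEq hker).trans
    (QuotientGroup.quotientKerEquivOfSurjective ψ hψ), fun g => ⟨φ g, rfl, rfl⟩⟩
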